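/- In Monotone Narrow Grid Tiling the input consists of integers $x,y,N\ge 1$ and a non-empty set $S_{i,j}\subseteq\{0,1\}\times[N]$ for every $(i,j)\in[x]\times[y]$. The question is whether one can choose $s_{i,j}\in S_{i,j}$ for all $(i,j)\in[x]\times[y]$ such that - if $s_{i,j}=(a,b)$ and $s_{i+1,j}=(a',b')$, then $a=a'$; - if $s_{i,j}=(a,b)$ and $s_{i,j+1}=(a',b')$, then $b\le b'$. The Exponential Time Hypothesis (ETH) states that there is $\delta>0$ such that 3-SAT with $n$ variables (the clauses of the input formula being distinct) cannot be solved in time $O(2^{\delta n})$. **Theorem.** Assume ETH. Then for every $b>0$ there exists $\varepsilon>0$ such that for every $C>0$ there is no algorithm that solves every instance $(x,y,N,\{S_{i,j}\})$ of Monotone Narrow Grid Tiling in time $C\cdot 2^{\varepsilon\cdot x\cdot y}\cdot N^{b}$. Here algorithms are deterministic multi-stack (equivalently, multi-tape) Turing machines, and time is their number of steps. -/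

import Mathlib

/-- The Turing machine `M` (a bundled multi-stack machine, with input and output over the binary
alphabet) decides the problem `P` on all instances `a : α`, given as the word `enc a`, and on the
instance `a` it halts after at most `t a` steps, with the correct one-bit answer as its output. -/
def DecidesInTime {α : Type} (enc : α → List Bool) (P : α → Prop) (t : α → ℝ)
    (M : Turing.TM2ComputableAux Bool Bool) : Prop :=
  ∀ a : α, ∃ (answer : Bool) (m : ℕ), (answer = true ↔ P a) ∧ (m : ℝ) ≤ t a ∧
    Nonempty (Turing.TM2OutputsInTime M.tm ((enc a).map M.inputAlphabet.symm)
      (some ([answer].map M.outputAlphabet.symm)) m)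

/-! ### 3-SAT and the Exponential Time Hypothesis -/

/-- A 3-CNF formula over the variables `0, …, n - 1`, with no clause listed twice. A literal
`(v, s)` is the variable `v` if `s = true` and its negation if `s = false`; a clause is a triple of
literals (shorter clauses repeat a literal). -/
structure ThreeCNF where
  n : ℕ
  clauses : List (Fin 3 → Fin n × Bool)
  nodup : clauses.Nodup

namespace ThreeCNF

/-- Some assignment makes a literal of every clause true. -/
def Satisfiable (φ : ThreeCNF) : Prop :=
  ∃ A : Fin φ.n → Bool, ∀ c ∈ φ.clauses, ∃ k : Fin 3, A (c k).1 = (c k).2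

/-- A literal: the index of the variable in unary, a delimiter, the sign. -/
def encodeLiteral {n : ℕ} (l : Fin n × Bool) : List Bool :=
  List.replicate (l.1 : ℕ) true ++ [false, l.2]

/-- The number of variables in unary, a delimiter, the literals of all clauses in order. -/
def encode (φ : ThreeCNF) : List Bool :=
  List.replicate φ.n true ++ [false] ++
    φ.clauses.flatMap fun c => (List.finRange 3).flatMap fun k => encodeLiteral (c k)

end ThreeCNF

/-- The Exponential Time Hypothesis: there is `δ > 0` such that 3-SAT with `n` variables cannot be
solved in time `O(2 ^ (δ n))`. -/
def ExponentialTimeHypothesis : Prop :=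
  ∃ δ : ℝ, 0 < δ ∧ ¬ ∃ (C : ℝ) (M : Turing.TM2ComputableAux Bool Bool),
    DecidesInTime ThreeCNF.encode ThreeCNF.Satisfiable
      (fun φ => C * (2 : ℝ) ^ (δ * (φ.n : ℝ))) M

/-! ### Monotone Narrow Grid Tiling -/

/-- An instance of (Monotone) Narrow Grid Tiling: a grid of `x ≥ 1` rows and `y ≥ 1` columns, an
integer `N`, and a non-empty set `S i j ⊆ {0, 1} × [N]` for each cell. -/
structure GridTilingInstance where
  x : ℕ
  y : ℕ
  N : ℕ
  x_pos : 0 < x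
  y_pos : 0 < y
  S : Fin x → Fin y → Finset (Bool × Fin N)
  S_nonempty : ∀ i j, (S i j).Nonempty

namespace GridTilingInstance

/-- The instance is a yes-instance of Monotone Narrow Grid Tiling: one can pick an element of each
cell's set so that the first components of vertically consecutive cells agree and the second
components do not decrease from a cell to the next one in its row. -/
def MonotoneSolvable (I : GridTilingInstance) : Prop :=
  ∃ s : Fin I.x → Fin I.y → Bool × Fin I.N,
    (∀ i j, s i j ∈ I.S i j) ∧
    (∀ (i i' : Fin I.x) (j : Fin I.y), (i' : ℕ) = (i : ℕ) + 1 → (s i j).1 = (s i' j).1) ∧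
    (∀ (i : Fin I.x) (j j' : Fin I.y), (j' : ℕ) = (j : ℕ) + 1 → (s i j).2 ≤ (s i j').2)

/-- `x`, `y` and `N` in unary, each followed by a delimiter, and then, cell by cell in row-major
order, the characteristic vector (of length `2 N`) of the set of the cell. -/
def encode (I : GridTilingInstance) : List Bool :=
  List.replicate I.x true ++ [false] ++
  List.replicate I.y true ++ [false] ++
  List.replicate I.N true ++ [false] ++
  (List.finRange I.x).flatMap fun i => (List.finRange I.y).flatMap fun j =>
    (List.finRange I.N).flatMap fun v =>
      [decide ((false, v) ∈ I.S i j), decide ((true, v) ∈ I.S i j)]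

end GridTilingInstance

/-! The proof reduces 3-SAT to tiling with a constant number of rows and a very small alphabet
exponent. Fix a constant `g`, pad the `n` variables to a multiple `m` of `g`, and split them into
`g` residue classes. Each 3-element set of classes gives two rows, so the number `R` of rows depends
on `g` only. A row for the set `T` stores in its second components an assignment `u` of the `c = 3 m
/ g` variables in the classes of `T`, read as a binary number; its companion stores the
complementary assignment. Cells have `N = 2 * 2 ^ c` values, and `v = 2 u` stands for `u`.

There are `2 m + 1` columns: one for each variable from the most to the least significant digit, a
check column, and one for each variable in the opposite order. The first component, shared by a
whole column, is the value of its variable, and a cell forces the corresponding digit of `u` to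
agree with it. Let `A` and `A'` be the assignments read off the left and the right half. Along a row
the numbers only grow, so fixing digits from the top down on the left makes the number at the check
column at least that of `A` (`digitsValue_le`), and on the right it is at most that of `A'`
(`le_digitsValue`). The companion row gives the same for the complements, which reverses the
inequality (`digitsValue_not`). Hence all are equal, and the check cell really sees `A` restricted
to `T`. There it is tested that no clause is falsified. The variables of any clause lie in three
classes, so some row sees all of them, and `A` satisfies the formula. Conversely a satisfying
assignment gives constant rows.

The product `x y` is about `2 R n` and `N ^ b` about `2 ^ (3 b n / g)`. With `g` large in terms of
`δ` and `b`, and then `ε` small in terms of `R`, a fast tiling algorithm would solve 3-SAT in time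
`O(2 ^ (δ n))`. The reduction itself costs `2 ^ c` times a polynomial. As time is counted in Turing
machine steps, it is implemented by an explicit machine (`runsIn_machine`), chained with the tiling
machine (`runsIn_compRev`). -/

open Turing StateTransition

/-! ### Time-bounded runs of transition systems -/

/-- The transition system `f` runs from `a` to `b` in at most `t` steps. -/
def RunsIn {α : Type*} (f : α → Option α) (a b : α) (t : ℕ) : Prop :=
  Nonempty (EvalsToInTime f a (some b) t)

namespace RunsIn

variable {α β : Type*} {f : α → Option α} {a b c : α} {s t : ℕ}

theorem refl (f : α → Option α) (a : α) (t : ℕ) : RunsIn f a a t :=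
  ⟨⟨EvalsTo.refl f a, Nat.zero_le t⟩⟩

theorem trans (h₁ : RunsIn f a b s) (h₂ : RunsIn f b c t) : RunsIn f a c (s + t) := by
  obtain ⟨h₁⟩ := h₁
  obtain ⟨h₂⟩ := h₂
  rw [Nat.add_comm]
  exact ⟨EvalsToInTime.trans f s t a b _ h₁ h₂⟩

theorem mono (h : RunsIn f a b s) (hst : s ≤ t) : RunsIn f a b t := by
  obtain ⟨h⟩ := h
  exact ⟨⟨h.toEvalsTo, h.steps_le_m.trans hst⟩⟩

theorem single (h : f a = some b) : RunsIn f a b 1 :=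
  ⟨⟨⟨1, by simpa [flip] using h⟩, le_refl 1⟩⟩

theorem head (h : f a = some b) (h₂ : RunsIn f b c t) : RunsIn f a c (t + 1) := by
  rw [Nat.add_comm]
  exact (single h).trans h₂

/-- Simulation principle: it transports the runs of either component into the composite machine with
no loss of time. -/
theorem map {f' : β → Option β} (φ : α → β)
    (hφ : ∀ a a', f a = some a' → f' (φ a) = some (φ a')) (h : RunsIn f a b t) :
    RunsIn f' (φ a) (φ b) t := by
  obtain ⟨⟨n, hn⟩, hnt⟩ := h
  refine ⟨⟨⟨n, ?_⟩, hnt⟩⟩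
  have key : ∀ n : ℕ, (flip bind f)^[n] (none : Option α) = none := by
    intro n
    induction n with
    | zero => rfl
    | succ n ih => rw [Function.iterate_succ_apply]; exact ih
  clear hnt
  induction n generalizing a with
  | zero => simp only [Function.iterate_zero, id] at hn ⊢; rw [Option.some.inj hn]
  | succ n ih =>
    rw [Function.iterate_succ_apply] at hn ⊢
    change (flip bind f)^[n] (f a) = some b at hn
    change (flip bind f')^[n] (f' (φ a)) = some (φ b)
    cases hfa : f a with
    | none => rw [hfa, key] at hn; cases hn
    | some a' => rw [hfa] at hn; rw [hφ a a' hfa]; exact ih hn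

end RunsIn

/-! ### Sequential composition of stack machines -/

namespace Turing.FinTM2

/-- Families of stack alphabets indexed by a sum type. -/
@[reducible] def sumAlphabet {K L : Type} (Γ : K → Type) (Δ : L → Type) : K ⊕ L → Type
  | .inl k => Γ k
  | .inr k => Δ k

/-- Stacks indexed by a sum type. -/
def joinStk {K L : Type} {Γ : K → Type} {Δ : L → Type} (S : ∀ k, List (Γ k))
    (T : ∀ k, List (Δ k)) : ∀ k : K ⊕ L, List (sumAlphabet Γ Δ k)
  | .inl k => S k
  | .inr k => T k

section joinStk

variable {K L : Type} [DecidableEq K] [DecidableEq L] {Γ : K → Type} {Δ : L → Type}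
  (S : ∀ k, List (Γ k)) (T : ∀ k, List (Δ k))

theorem update_joinStk_inl (k : K) (l : List (Γ k)) :
    Function.update (joinStk S T) (Sum.inl k) l = joinStk (Function.update S k l) T := by
  refine Eq.symm (Function.eq_update_iff.2 ⟨?_, ?_⟩)
  · exact Function.update_self k l S
  rintro (k' | k') h
  · exact Function.update_of_ne (fun e => h (congrArg _ e)) l S
  · rfl

theorem update_joinStk_inr (k : L) (l : List (Δ k)) :
    Function.update (joinStk S T) (Sum.inr k) l = joinStk S (Function.update T k l) := by
  refine Eq.symm (Function.eq_update_iff.2 ⟨?_, ?_⟩)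
  · exact Function.update_self k l T
  rintro (k' | k') h
  · rfl
  · exact Function.update_of_ne (fun e => h (congrArg _ e)) l T

omit [DecidableEq K] [DecidableEq L] in
theorem joinStk_nil :
    joinStk (Γ := Γ) (Δ := Δ) (fun _ => []) (fun _ => []) = fun _ => [] := by
  funext k; cases k <;> rfl

end joinStk

variable (A B : FinTM2)

/-- The statements of the first machine, as statements of the composite machine: instead of
halting, control passes to the label `Sum.inr none`, which transfers the output. -/
def leftStmt : TM2.Stmt A.Γ A.Λ A.σ →
    TM2.Stmt (sumAlphabet A.Γ B.Γ) (A.Λ ⊕ Option B.Λ) (A.σ × B.σ × Option Bool)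
  | .push k f q => .push (Sum.inl k) (fun s => f s.1) (leftStmt q)
  | .peek k f q => .peek (Sum.inl k) (fun s o => (f s.1 o, s.2)) (leftStmt q)
  | .pop k f q => .pop (Sum.inl k) (fun s o => (f s.1 o, s.2)) (leftStmt q)
  | .load f q => .load (fun s => (f s.1, s.2)) (leftStmt q)
  | .branch f q₁ q₂ => .branch (fun s => f s.1) (leftStmt q₁) (leftStmt q₂)
  | .goto f => .goto fun s => Sum.inl (f s.1)
  | .halt => .goto fun _ => Sum.inr none

/-- The statements of the second machine, as statements of the composite machine. -/
def rightStmt : TM2.Stmt B.Γ B.Λ B.σ →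
    TM2.Stmt (sumAlphabet A.Γ B.Γ) (A.Λ ⊕ Option B.Λ) (A.σ × B.σ × Option Bool)
  | .push k f q => .push (Sum.inr k) (fun s => f s.2.1) (rightStmt q)
  | .peek k f q => .peek (Sum.inr k) (fun s o => (s.1, f s.2.1 o, s.2.2)) (rightStmt q)
  | .pop k f q => .pop (Sum.inr k) (fun s o => (s.1, f s.2.1 o, s.2.2)) (rightStmt q)
  | .load f q => .load (fun s => (s.1, f s.2.1, s.2.2)) (rightStmt q)
  | .branch f q₁ q₂ => .branch (fun s => f s.2.1) (rightStmt q₁) (rightStmt q₂)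
  | .goto f => .goto fun s => Sum.inr (some (f s.2.1))
  | .halt => .halt

variable {A B}

/-- A configuration of the first machine inside the composite machine. -/
def leftCfg (T : ∀ k, List (B.Γ k)) (b : B.σ × Option Bool) (c : TM2.Cfg A.Γ A.Λ A.σ) :
    TM2.Cfg (sumAlphabet A.Γ B.Γ) (A.Λ ⊕ Option B.Λ) (A.σ × B.σ × Option Bool) where
  l := some (c.l.elim (Sum.inr none) Sum.inl)
  var := (c.var, b)
  stk := joinStk c.stk T

/-- A configuration of the second machine inside the composite machine. -/
def rightCfg (S : ∀ k, List (A.Γ k)) (a : A.σ) (o : Option Bool) (c : TM2.Cfg B.Γ B.Λ B.σ) :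
    TM2.Cfg (sumAlphabet A.Γ B.Γ) (A.Λ ⊕ Option B.Λ) (A.σ × B.σ × Option Bool) where
  l := c.l.map fun l => Sum.inr (some l)
  var := (a, c.var, o)
  stk := joinStk S c.stk

theorem stepAux_leftStmt (q : TM2.Stmt A.Γ A.Λ A.σ) (v : A.σ) (b : B.σ × Option Bool)
    (S : ∀ k, List (A.Γ k)) (T : ∀ k, List (B.Γ k)) :
    TM2.stepAux (leftStmt A B q) (v, b) (joinStk S T) = leftCfg T b (TM2.stepAux q v S) := by
  induction q generalizing v S with
  | push k f q ih =>
    exact (congrArg _ (update_joinStk_inl S T k _)).trans (ih _ _)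
  | peek k f q ih => exact ih _ _
  | pop k f q ih =>
    exact (congrArg _ (update_joinStk_inl S T k _)).trans (ih _ _)
  | load f q ih => exact ih _ _
  | branch f q₁ q₂ ih₁ ih₂ =>
    simp only [leftStmt, TM2.stepAux]
    cases f v
    · exact ih₂ _ _
    · exact ih₁ _ _
  | goto f => rfl
  | halt => rfl

theorem stepAux_rightStmt (q : TM2.Stmt B.Γ B.Λ B.σ) (a : A.σ) (v : B.σ) (o : Option Bool)
    (S : ∀ k, List (A.Γ k)) (T : ∀ k, List (B.Γ k)) :
    TM2.stepAux (rightStmt A B q) (a, v, o) (joinStk S T) =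
      rightCfg S a o (TM2.stepAux q v T) := by
  induction q generalizing v T with
  | push k f q ih =>
    exact (congrArg _ (update_joinStk_inr S T k _)).trans (ih _ _)
  | peek k f q ih => exact ih _ _
  | pop k f q ih =>
    exact (congrArg _ (update_joinStk_inr S T k _)).trans (ih _ _)
  | load f q ih => exact ih _ _
  | branch f q₁ q₂ ih₁ ih₂ =>
    simp only [rightStmt, TM2.stepAux]
    cases f v
    · exact ih₂ _ _
    · exact ih₁ _ _
  | goto f => rfl
  | halt => rfl

/-- The machine that runs `A`, moves its output, read as a word over the binary alphabet and
reversed on the way, to the input stack of `B`, and runs `B`. -/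
def compRev (A B : FinTM2) (out : A.Γ A.k₁ → Bool) (inp : Bool → B.Γ B.k₀) : FinTM2 where
  K := A.K ⊕ B.K
  kDecidableEq := inferInstance
  kFin := @instFintypeSum _ _ A.kFin B.kFin
  k₀ := Sum.inl A.k₀
  k₁ := Sum.inr B.k₁
  Γ := sumAlphabet A.Γ B.Γ
  Λ := A.Λ ⊕ Option B.Λ
  main := Sum.inl A.main
  ΛFin := @instFintypeSum _ _ A.ΛFin (@instFintypeOption _ B.ΛFin)
  -- The last factor holds the bit in transit between the two machines.
  σ := A.σ × B.σ × Option Bool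
  initialState := (A.initialState, B.initialState, none)
  σFin := @instFintypeProd _ _ A.σFin (@instFintypeProd _ _ B.σFin inferInstance)
  Γk₀Fin := A.Γk₀Fin
  m
    | Sum.inl l => leftStmt A B (A.m l)
    | Sum.inr (some l) => rightStmt A B (B.m l)
    | Sum.inr none =>
      .pop (Sum.inl A.k₁) (fun s o => (s.1, s.2.1, o.map out)) <|
        .branch (fun s => s.2.2.isSome)
          (.push (Sum.inr B.k₀) (fun s => inp (s.2.2.getD false)) <|
            .goto fun _ => Sum.inr none)
          (.goto fun _ => Sum.inr (some B.main))

theorem initList_stk (tm : FinTM2) (s : List (tm.Γ tm.k₀)) :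
    (initList tm s).stk = Function.update (fun _ => []) tm.k₀ s := by
  funext k
  by_cases h : k = tm.k₀
  · subst h; simp [initList]
  · simp [initList, h]

theorem haltList_stk (tm : FinTM2) (s : List (tm.Γ tm.k₁)) :
    (haltList tm s).stk = Function.update (fun _ => []) tm.k₁ s := by
  funext k
  by_cases h : k = tm.k₁
  · subst h; simp [haltList]
  · simp [haltList, h]

theorem initList_compRev (out : A.Γ A.k₁ → Bool) (inp : Bool → B.Γ B.k₀)
    (s : List (A.Γ A.k₀)) :
    initList (compRev A B out inp) s =
      leftCfg (fun _ => []) (B.initialState, none) (initList A s) := by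
  have h : (initList (compRev A B out inp) s).stk = joinStk (initList A s).stk (fun _ => []) := by
    rw [initList_stk A, ← update_joinStk_inl, joinStk_nil]
    exact initList_stk (compRev A B out inp) s
  exact congrArg (TM2.Cfg.mk _ _) h

theorem haltList_compRev (out : A.Γ A.k₁ → Bool) (inp : Bool → B.Γ B.k₀)
    (s : List (B.Γ B.k₁)) :
    haltList (compRev A B out inp) s =
      rightCfg (fun _ => []) A.initialState none (haltList B s) := by
  have h : (haltList (compRev A B out inp) s).stk = joinStk (fun _ => []) (haltList B s).stk := by
    rw [haltList_stk B, ← update_joinStk_inr, joinStk_nil]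
    exact haltList_stk (compRev A B out inp) s
  exact congrArg (TM2.Cfg.mk _ _) h

/-- Popping from one stack and pushing on the other reverses the word. The last, unsuccessful pop
resets the transit bit to `none`, as the final configuration must carry the initial register. -/
theorem runsIn_transfer (out : A.Γ A.k₁ → Bool) (inp : Bool → B.Γ B.k₀)
    (w : List (A.Γ A.k₁)) (u : List (B.Γ B.k₀)) (o : Option Bool) :
    RunsIn (compRev A B out inp).step
      (⟨some (Sum.inr none), (A.initialState, B.initialState, o),
        joinStk (Function.update (fun _ => []) A.k₁ w)
          (Function.update (fun _ => []) B.k₀ u)⟩ : TM2.Cfg _ _ _)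
      (rightCfg (fun _ => []) A.initialState none
        (initList B ((w.map fun x => inp (out x)).reverse ++ u))) (w.length + 1) := by
  induction w generalizing u o with
  | nil =>
    refine RunsIn.single (congrArg some ?_)
    have key : ∀ (S : ∀ k, List (A.Γ k)) (T : ∀ k, List (B.Γ k)), S A.k₁ = [] →
        TM2.stepAux ((compRev A B out inp).m (Sum.inr none))
          (A.initialState, B.initialState, o) (joinStk S T) =
        ⟨some (Sum.inr (some B.main)), (A.initialState, B.initialState, none),
          joinStk (Function.update S A.k₁ []) T⟩ := by
      intro S T hS
      have hS' : joinStk S T (Sum.inl A.k₁) = [] := hS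
      simp only [compRev, TM2.stepAux]
      rw [hS']
      exact congrArg (TM2.Cfg.mk _ _) (update_joinStk_inl S T A.k₁ [])
    refine (key _ _ (Function.update_self _ _ _)).trans ?_
    exact congrArg (TM2.Cfg.mk _ _) (congrArg₂ joinStk (by simp) (initList_stk B u).symm)
  | cons x w ih =>
    have h := ih (inp (out x) :: u) (some (out x))
    rw [List.map_cons, List.reverse_cons, List.append_assoc]
    refine RunsIn.head (congrArg some ?_) h
    have key : ∀ (S : ∀ k, List (A.Γ k)) (T : ∀ k, List (B.Γ k)), S A.k₁ = x :: w →
        TM2.stepAux ((compRev A B out inp).m (Sum.inr none))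
          (A.initialState, B.initialState, o) (joinStk S T) =
        ⟨some (Sum.inr none), (A.initialState, B.initialState, some (out x)),
          joinStk (Function.update S A.k₁ w)
            (Function.update T B.k₀ (inp (out x) :: T B.k₀))⟩ := by
      intro S T hS
      have hS' : joinStk S T (Sum.inl A.k₁) = x :: w := hS
      simp only [compRev, TM2.stepAux]
      rw [hS']
      refine congrArg (TM2.Cfg.mk _ _) ?_
      refine (congrArg (fun R : ∀ k, List (sumAlphabet A.Γ B.Γ k) => Function.update R
        (Sum.inr B.k₀) (inp (out x) :: R (Sum.inr B.k₀)))
        (update_joinStk_inl S T A.k₁ w)).trans ?_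
      exact update_joinStk_inr _ _ _ _
    refine (key _ _ (Function.update_self _ _ _)).trans ?_
    exact congrArg (TM2.Cfg.mk _ _) (congrArg₂ joinStk (by simp) (by simp))

theorem runsIn_compRev (out : A.Γ A.k₁ → Bool) (inp : Bool → B.Γ B.k₀)
    {u : List (A.Γ A.k₀)} {w : List (A.Γ A.k₁)} {r : List (B.Γ B.k₁)} {s t : ℕ}
    (hA : RunsIn A.step (initList A u) (haltList A w) s)
    (hB : RunsIn B.step (initList B (w.map fun x => inp (out x)).reverse) (haltList B r) t) :
    RunsIn (compRev A B out inp).step (initList (compRev A B out inp) u)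
      (haltList (compRev A B out inp) r) (s + (w.length + 1) + t) := by
  rw [initList_compRev, haltList_compRev]
  have h₁ := hA.map (f' := (compRev A B out inp).step)
    (leftCfg (fun _ => []) (B.initialState, none)) (by
      rintro ⟨_ | l, v, S⟩ c' h
      · cases h
      · obtain rfl := Option.some.inj h
        exact congrArg some (stepAux_leftStmt _ _ _ _ _))
  have h₃ := hB.map (f' := (compRev A B out inp).step)
    (rightCfg (fun _ => []) A.initialState none) (by
      rintro ⟨_ | l, v, S⟩ c' h
      · cases h
      · obtain rfl := Option.some.inj h
        exact congrArg some (stepAux_rightStmt _ _ _ _ _ _))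
  refine (h₁.trans ?_).trans h₃
  have h₂ := runsIn_transfer out inp w [] none
  simp only [List.append_nil, Function.update_eq_self] at h₂
  rw [← haltList_stk A w] at h₂
  exact h₂

end Turing.FinTM2

/-! ### Words of digits -/

/-- The binary digits of `v`, least significant first, spread over the positions of `G` that are
active; the digit at an inactive position is `false`. -/
def digits {γ : Type} (act : γ → Bool) : List γ → ℕ → List (γ × Bool)
  | [], _ => []
  | c :: G, v =>
    if act c then (c, decide (v % 2 = 1)) :: digits act G (v / 2) else (c, false) :: digits act G v

theorem digits_length {γ : Type} (act : γ → Bool) (G : List γ) (v : ℕ) :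
    (digits act G v).length = G.length := by
  induction G generalizing v with
  | nil => rfl
  | cons c G ih => rw [digits]; split <;> simp [ih]

theorem digits_zero {γ : Type} (act : γ → Bool) (G : List γ) :
    digits act G 0 = G.map fun c => (c, false) := by
  induction G with
  | nil => rfl
  | cons c G ih => rw [digits]; split <;> simp [ih]

/-- The counter wraps around: after an overflow the word is zero again and ready for the next cell.
-/
theorem digits_two_pow {γ : Type} (act : γ → Bool) (G : List γ) :
    digits act G (2 ^ G.countP act) = digits act G 0 := by
  induction G with
  | nil => rfl
  | cons c G ih =>
    by_cases h : act c
    · simp only [digits, h, if_true, List.countP_cons_of_pos, pow_succ]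
      simp [ih]
    · simp [digits, h, ih]

/-- The groups of the positions `m - 1, …, 0`, where position `t` lies in the residue class
of `t`. -/
def residues (g : ℕ) : ℕ → List (ZMod g)
  | 0 => []
  | m + 1 => (m : ZMod g) :: residues g m

theorem residues_length (g m : ℕ) : (residues g m).length = m := by
  induction m with
  | zero => rfl
  | succ m ih => simp [residues, ih]

/-! ### The machine that writes down the grid -/

namespace GridWriter

/-- The stacks: the formula and the part of it that has been read, the word of digits and the part
of it that has been read, two unary counters for the column, the output. -/
inductive Stk
  | inp | inp2 | w | w2 | p | q | out
deriving DecidableEq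

instance : Fintype Stk where
  elems := {.inp, .inp2, .w, .w2, .p, .q, .out}
  complete x := by cases x <;> simp

/-- The stack alphabets. -/
@[reducible] def alphabet (γ : Type) : Stk → Type
  | .inp | .inp2 | .p | .q | .out => Bool
  | .w | .w2 => γ × Bool

/-- The contents of all stacks. -/
structure Mem (γ : Type) where
  inp : List Bool
  inp2 : List Bool
  w : List (γ × Bool)
  w2 : List (γ × Bool)
  p : List Bool
  q : List Bool
  out : List Bool

/-- The contents as a family of stacks. -/
def Mem.stk {γ : Type} (m : Mem γ) : ∀ k, List (alphabet γ k)
  | .inp => m.inp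
  | .inp2 => m.inp2
  | .w => m.w
  | .w2 => m.w2
  | .p => m.p
  | .q => m.q
  | .out => m.out

section update

variable {γ : Type} (a b p q o : List Bool) (w x : List (γ × Bool))

@[simp] theorem stk_inp : (Mem.mk a b w x p q o).stk .inp = a := rfl
@[simp] theorem stk_inp2 : (Mem.mk a b w x p q o).stk .inp2 = b := rfl
@[simp] theorem stk_w : (Mem.mk a b w x p q o).stk .w = w := rfl
@[simp] theorem stk_w2 : (Mem.mk a b w x p q o).stk .w2 = x := rfl
@[simp] theorem stk_p : (Mem.mk a b w x p q o).stk .p = p := rfl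
@[simp] theorem stk_q : (Mem.mk a b w x p q o).stk .q = q := rfl
@[simp] theorem stk_out : (Mem.mk a b w x p q o).stk .out = o := rfl

@[simp] theorem update_inp (l : List Bool) :
    Function.update (Mem.mk a b w x p q o).stk .inp l = (Mem.mk l b w x p q o).stk := by
  funext k; cases k <;> rfl

@[simp] theorem update_inp2 (l : List Bool) :
    Function.update (Mem.mk a b w x p q o).stk .inp2 l = (Mem.mk a l w x p q o).stk := by
  funext k; cases k <;> rfl

@[simp] theorem update_w (l : List (γ × Bool)) :
    Function.update (Mem.mk a b w x p q o).stk .w l = (Mem.mk a b l x p q o).stk := by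
  funext k; cases k <;> rfl

@[simp] theorem update_w2 (l : List (γ × Bool)) :
    Function.update (Mem.mk a b w x p q o).stk .w2 l = (Mem.mk a b w l p q o).stk := by
  funext k; cases k <;> rfl

@[simp] theorem update_p (l : List Bool) :
    Function.update (Mem.mk a b w x p q o).stk .p l = (Mem.mk a b w x l q o).stk := by
  funext k; cases k <;> rfl

@[simp] theorem update_q (l : List Bool) :
    Function.update (Mem.mk a b w x p q o).stk .q l = (Mem.mk a b w x p l o).stk := by
  funext k; cases k <;> rfl

@[simp] theorem update_out (l : List Bool) :
    Function.update (Mem.mk a b w x p q o).stk .out l = (Mem.mk a b w x p q l).stk := by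
  funext k; cases k <;> rfl

end update

/-- What is written for each value of the digits: a unary `2`, or the cell of a column left of the
check column, of the check column, or of a column right of it. -/
inductive Kind
  | header | first | check | second
deriving DecidableEq

instance : Fintype Kind where
  elems := {.header, .first, .check, .second}
  complete x := by cases x <;> simp

/-- The labels. `i` is the current row, `s` tells whether the current clause already has a true
literal, `ok` whether the previous clauses are satisfied. -/
inductive Lbl (γ ρ : Type)
  | start
  | read (c : γ)
  | pad (c : γ)
  | emit (i : ρ) (κ : Kind)
  | walk (i : ρ) (κ : Kind)
  | back (i : ρ) (κ : Kind)
  | lit (i : ρ) (k : Fin 3) (s ok : Bool)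
  | sign (i : ρ) (k : Fin 3) (s ok : Bool)
  | ret (i : ρ) (k : Fin 3) (s ok : Bool)
  | rewind (i : ρ) (ok : Bool)
  | inc (i : ρ) (κ : Kind)
  | carry (i : ρ) (κ : Kind) (overflow : Bool)
  | next (i : ρ) (κ : Kind)
  | firstCol (i : ρ)
  | secondCol (i : ρ)
  | clean
deriving Fintype

/-- The register: the bit and the digit that have been read last. -/
abbrev Reg (γ : Type) : Type := Option Bool × Option (γ × Bool)

variable {g R : ℕ} (act : Fin R → ZMod g → Bool) (lo : Fin R → Bool)

/-- Whether row `i` lets a position with digit `x` have the value `a`. -/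
def fits (i : Fin R) (x : ZMod g × Bool) (a : Bool) : Bool :=
  !act i x.1 || a == xor x.2 (lo i)

/-- The part of the register that holds a digit. -/
def Reg.digit (v : Reg (ZMod g)) : ZMod g × Bool :=
  v.2.getD (0, false)

/-- The part of the register that holds a bit. -/
def Reg.bit (v : Reg (ZMod g)) : Bool :=
  v.1.getD false

/-- Statements of the machine. -/
abbrev Code (g R : ℕ) : Type := TM2.Stmt (alphabet (ZMod g)) (Lbl (ZMod g) (Fin R)) (Reg (ZMod g))

/-- Write a list of bits. -/
def write (l : List Bool) (c : Code g R) : Code g R :=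
  l.foldr (fun b c => .push .out (fun _ => b) c) c

/-- The program. -/
def code [NeZero R] : Lbl (ZMod g) (Fin R) → Code g R
  | .start => write (List.replicate R true ++ [false]) <| .goto fun _ => .read 0
  | .read c =>
    .pop .inp (fun v o => (o, v.2)) <|
    .branch (fun v => v.bit)
      (.push .w (fun _ => (c, false)) <| .push .p (fun _ => true) <| write [true, true] <|
        .goto fun _ => .read (c + 1))
      (.goto fun _ => .pad c)
  | .pad c =>
    -- The class `c` is the number of positions so far modulo `g`, so padding stops at a multiple of
    -- `g`. Every position has written two marks; the extra one gives `2 m + 1` columns.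
    if c = 0 then write [true, false] <| .goto fun _ => .emit 0 .header
    else .push .w (fun _ => (c, false)) <| .push .p (fun _ => true) <| write [true, true] <|
      .goto fun _ => .pad (c + 1)
  -- Two marks for each of the `2 ^ c` words make `N = 2 * 2 ^ c` in unary, with no separate
  -- arithmetic.
  | .emit i .header => write [true, true] <| .goto fun _ => .inc i .header
  | .emit i .check => .goto fun _ => .lit i 0 false true
  | .emit i .first => .goto fun _ => .walk i .first
  | .emit i .second => .goto fun _ => .walk i .second
  | .walk i κ =>
    .pop .p (fun v o => (o, v.2)) <|
    .branch (fun v => v.1.isSome)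
      (.pop .w (fun v o => (v.1, o)) <| .push .w2 (fun v => v.digit) <| .goto fun _ => .walk i κ)
      (.peek .w (fun v o => (v.1, o)) <| .push .out (fun v => fits act lo i v.digit false) <|
        .push .out (fun v => fits act lo i v.digit true) <| write [false, false] <|
        .goto fun _ => .back i κ)
  | .back i κ =>
    .pop .w2 (fun v o => (v.1, o)) <|
    .branch (fun v => v.2.isSome)
      (.push .w (fun v => v.digit) <| .push .p (fun _ => true) <| .goto fun _ => .back i κ)
      (.goto fun _ => .inc i κ)
  | .lit i k s ok =>
    .pop .inp (fun v o => (o, v.2)) <|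
    .branch (fun v => v.1.isNone) (.goto fun _ => .rewind i ok) <|
    .push .inp2 (fun v => v.bit) <|
    .branch (fun v => v.bit)
      (.pop .w (fun v o => (v.1, o)) <| .push .w2 (fun v => v.digit) <|
        .goto fun _ => .lit i k s ok)
      (.goto fun _ => .sign i k s ok)
  | .sign i k s ok =>
    .pop .inp (fun v o => (o, v.2)) <|
    .push .inp2 (fun v => v.bit) <|
    .peek .w (fun v o => (v.1, o)) <|
    .goto fun v => .ret i k (s || fits act lo i v.digit v.bit) ok
  | .ret i k s ok =>
    .pop .w2 (fun v o => (v.1, o)) <|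
    .branch (fun v => v.2.isSome)
      (.push .w (fun v => v.digit) <| .goto fun _ => .ret i k s ok)
      (.goto fun _ => if k = 2 then .lit i 0 false (ok && s) else .lit i (k + 1) s ok)
  | .rewind i ok =>
    .pop .inp2 (fun v o => (o, v.2)) <|
    .branch (fun v => v.1.isSome)
      (.push .inp (fun v => v.bit) <| .goto fun _ => .rewind i ok)
      (write [ok, ok, true, true] <| .goto fun _ => .inc i .check)
  | .inc i κ =>
    .pop .w (fun v o => (v.1, o)) <|
    .branch (fun v => v.2.isNone) (.goto fun _ => .carry i κ true) <|
    .branch (fun v => act i v.digit.1)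
      (.branch (fun v => v.digit.2)
        (.push .w2 (fun v => (v.digit.1, false)) <| .goto fun _ => .inc i κ)
        (.push .w (fun v => (v.digit.1, true)) <| .goto fun _ => .carry i κ false))
      (.push .w2 (fun v => v.digit) <| .goto fun _ => .inc i κ)
  | .carry i κ o =>
    .pop .w2 (fun v o => (v.1, o)) <|
    .branch (fun v => v.2.isSome)
      (.push .w (fun v => v.digit) <| .goto fun _ => .carry i κ o)
      (.goto fun _ => if o then .next i κ else .emit i κ)
  | .next i .header => write [false] <| .goto fun _ => .firstCol i
  | .next i .first => .goto fun _ => .firstCol i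
  | .next i .check => .goto fun _ => .secondCol i
  | .next i .second => .push .p (fun _ => true) <| .goto fun _ => .secondCol i
  | .firstCol i =>
    .pop .p (fun v o => (o, v.2)) <|
    .branch (fun v => v.1.isSome)
      (.push .q (fun _ => true) <| .goto fun _ => .emit i .first)
      (.goto fun _ => .emit i .check)
  | .secondCol i =>
    .pop .q (fun v o => (o, v.2)) <|
    .branch (fun v => v.1.isSome)
      (.goto fun _ => .emit i .second)
      (.goto fun _ => if h : i.1 + 1 < R then .firstCol ⟨i.1 + 1, h⟩ else .clean)
  | .clean =>
    .pop .inp (fun v o => (o, v.2)) <|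
    .branch (fun v => v.1.isSome) (.goto fun _ => .clean) <|
    .pop .p (fun v o => (o, v.2)) <|
    .branch (fun v => v.1.isSome) (.goto fun _ => .clean) <|
    .pop .w (fun v o => (v.1, o)) <|
    .branch (fun v => v.2.isSome) (.goto fun _ => .clean) <|
    .halt

/-- The machine. -/
def machine [NeZero g] [NeZero R] : FinTM2 where
  K := Stk
  k₀ := .inp
  k₁ := .out
  Γ := alphabet (ZMod g)
  Λ := Lbl (ZMod g) (Fin R)
  main := .start
  ΛFin := haveI := ZMod.fintype g; inferInstance
  σ := Reg (ZMod g)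
  initialState := (none, none)
  σFin := haveI := ZMod.fintype g; inferInstance
  Γk₀Fin := inferInstanceAs (Fintype Bool)
  m := code act lo

theorem stepAux_write (l : List Bool) (c : Code g R) (v : Reg (ZMod g))
    (a b p q o : List Bool) (w x : List (ZMod g × Bool)) :
    TM2.stepAux (write l c) v (Mem.mk a b w x p q o).stk =
      TM2.stepAux c v (Mem.mk a b w x p q (l.reverse ++ o)).stk := by
  induction l generalizing o with
  | nil => rfl
  | cons b l ih =>
    have : write (b :: l) c = .push .out (fun _ => b) (write l c) := rfl
    rw [this, TM2.stepAux, stk_out, update_out, ih]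
    simp

end GridWriter

/-! ### Runs of the grid writer on a single cell -/

namespace GridWriter

variable {g R : ℕ} (act : Fin R → ZMod g → Bool) (lo : Fin R → Bool)

/-- From the label `l` and the stacks `m` the program gets, whatever the register holds, to the
label `l'` and the stacks `m'` in at most `t` steps. -/
def Reach [NeZero R] (l : Lbl (ZMod g) (Fin R)) (m : Mem (ZMod g)) (l' : Lbl (ZMod g) (Fin R))
    (m' : Mem (ZMod g)) (t : ℕ) : Prop :=
  ∀ v : Reg (ZMod g), ∃ v', RunsIn (TM2.step (code act lo)) ⟨some l, v, m.stk⟩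
    ⟨some l', v', m'.stk⟩ t

variable [NeZero R] {act lo} {l l' l'' : Lbl (ZMod g) (Fin R)} {m m' m'' : Mem (ZMod g)} {s t : ℕ}

theorem Reach.refl : Reach act lo l m l m t := fun v => ⟨v, RunsIn.refl _ _ _⟩

theorem Reach.trans (h₁ : Reach act lo l m l' m' s) (h₂ : Reach act lo l' m' l'' m'' t) :
    Reach act lo l m l'' m'' (s + t) := fun v => by
  obtain ⟨v', h₁⟩ := h₁ v
  obtain ⟨v'', h₂⟩ := h₂ v'
  exact ⟨v'', h₁.trans h₂⟩

theorem Reach.mono (h : Reach act lo l m l' m' s) (hst : s ≤ t) : Reach act lo l m l' m' t :=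
  fun v => (h v).imp fun _ h => h.mono hst

theorem Reach.head
    (h₁ : ∀ v, ∃ v', TM2.stepAux (code act lo l) v m.stk = ⟨some l', v', m'.stk⟩)
    (h₂ : Reach act lo l' m' l'' m'' t) : Reach act lo l m l'' m'' (t + 1) := fun v => by
  obtain ⟨v', h₁⟩ := h₁ v
  obtain ⟨v'', h₂⟩ := h₂ v'
  exact ⟨v'', RunsIn.head (congrArg some h₁) h₂⟩

theorem Reach.single
    (h₁ : ∀ v, ∃ v', TM2.stepAux (code act lo l) v m.stk = ⟨some l', v', m'.stk⟩) :
    Reach act lo l m l' m' 1 :=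
  Reach.head (t := 0) h₁ Reach.refl

theorem replicate_append_cons {α : Type*} (n : ℕ) (x : α) (l : List α) :
    List.replicate n x ++ x :: l = x :: (List.replicate n x ++ l) := by
  rw [← List.singleton_append, ← List.append_assoc, ← List.replicate_succ', List.replicate_succ]
  rfl

/-! ### Cells of the variable columns -/

section column

variable (i : Fin R) (κ : Kind) (a b q o : List Bool)

/-- The four bits written in a column for the values `2 u` and `2 u + 1`, if the digit of the
column is `x`. -/
def columnBits (act : Fin R → ZMod g → Bool) (lo : Fin R → Bool) (i : Fin R) (x : ZMod g × Bool) :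
    List Bool :=
  [fits act lo i x false, fits act lo i x true, false, false]

/-- The unary counter `p` is the position of the column: one digit is skipped per mark, which brings
the required digit to the top. -/
theorem reach_walk (A B X : List (ZMod g × Bool)) (x : ZMod g × Bool) :
    Reach act lo (.walk i κ) ⟨a, b, A ++ x :: B, X, List.replicate A.length true, q, o⟩
      (.back i κ) ⟨a, b, x :: B, A.reverse ++ X, [], q, (columnBits act lo i x).reverse ++ o⟩
      (A.length + 1) := by
  induction A generalizing X with
  | nil =>
    refine Reach.single fun v => ?_
    simp [code, stepAux_write, Reg.digit, columnBits]
  | cons y A ih =>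
    refine Reach.head (fun v => ?_) (by simpa using ih (y :: X))
    simp [code, Reg.digit, List.replicate_succ]

theorem reach_back (w X : List (ZMod g × Bool)) (j : ℕ) :
    Reach act lo (.back i κ) ⟨a, b, w, X, List.replicate j true, q, o⟩
      (.inc i κ) ⟨a, b, X.reverse ++ w, [], List.replicate (j + X.length) true, q, o⟩
      (X.length + 1) := by
  induction X generalizing w j with
  | nil =>
    refine Reach.single fun v => ?_
    simp [code]
  | cons y X ih =>
    have h := ih (y :: w) (j + 1)
    rw [show j + 1 + X.length = j + (y :: X).length by simp; omega] at h
    refine Reach.head (fun v => ?_) (by simpa using h)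
    simp [code, Reg.digit, List.replicate_succ]

theorem reach_column (hκ : κ = .first ∨ κ = .second) (w : List (ZMod g × Bool)) (j : ℕ)
    (hj : j < w.length) :
    Reach act lo (.emit i κ) ⟨a, b, w, [], List.replicate j true, q, o⟩
      (.inc i κ) ⟨a, b, w, [], List.replicate j true, q,
        (columnBits act lo i w[j]).reverse ++ o⟩ (2 * j + 3) := by
  have hw : w.take j ++ w[j] :: w.drop (j + 1) = w := by
    rw [List.getElem_cons_drop, List.take_append_drop]
  have hl : (w.take j).length = j := by simp; omega
  have h₁ := reach_walk (act := act) (lo := lo) i κ a b q o (w.take j) (w.drop (j + 1)) [] w[j]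
  have h₂ := reach_back (act := act) (lo := lo) i κ a b q ((columnBits act lo i w[j]).reverse ++ o)
    (w[j] :: w.drop (j + 1)) (w.take j).reverse 0
  simp only [hw, hl, List.append_nil, List.reverse_reverse, List.length_reverse, zero_add,
    List.replicate_zero] at h₁ h₂
  refine (Reach.head (fun v => ?_) (h₁.trans h₂)).mono (by omega)
  rcases hκ with rfl | rfl <;> simp [code]

end column

/-! ### Cells of the check column: evaluating the formula -/

section check

variable (i : Fin R) (k : Fin 3) (s ok : Bool) (r c p q o : List Bool)

theorem reach_lit (A B X : List (ZMod g × Bool)) (x : ZMod g × Bool) (d : Bool) :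
    Reach act lo (.lit i k s ok)
      ⟨List.replicate A.length true ++ [false, d] ++ r, c, A ++ x :: B, X, p, q, o⟩
      (.ret i k (s || fits act lo i x d) ok)
      ⟨r, (List.replicate A.length true ++ [false, d]).reverse ++ c, x :: B, A.reverse ++ X,
        p, q, o⟩ (A.length + 2) := by
  induction A generalizing X c with
  | nil =>
    refine Reach.head (l' := .sign i k s ok) (m' := ⟨d :: r, false :: c, x :: B, X, p, q, o⟩)
      (fun v => ?_) (Reach.single fun v => ?_)
    · simp [code, Reg.bit]
    · simp [code, Reg.bit, Reg.digit]
  | cons y A ih =>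
    refine Reach.head (fun v => ?_) (by simpa [replicate_append_cons, List.replicate_succ] using ih (true :: c) (y :: X))
    simp [code, Reg.digit, Reg.bit, List.replicate_succ]

/-- The label after a literal. -/
def afterLit (i : Fin R) (k : Fin 3) (s ok : Bool) : Lbl (ZMod g) (Fin R) :=
  if k = 2 then .lit i 0 false (ok && s) else .lit i (k + 1) s ok

theorem reach_ret (w X : List (ZMod g × Bool)) :
    Reach act lo (.ret i k s ok) ⟨r, c, w, X, p, q, o⟩ (afterLit i k s ok)
      ⟨r, c, X.reverse ++ w, [], p, q, o⟩ (X.length + 1) := by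
  induction X generalizing w with
  | nil =>
    refine Reach.single fun v => ?_
    simp [code, afterLit]
  | cons y X ih =>
    refine Reach.head (fun v => ?_) (by simpa using ih (y :: w))
    simp [code, Reg.digit]

/-- Whether row `i` does not falsify the literal `l` under the digits `w`. -/
def litFits (act : Fin R → ZMod g → Bool) (lo : Fin R → Bool) (i : Fin R)
    (w : List (ZMod g × Bool)) {n : ℕ} (l : Fin n × Bool) : Bool :=
  fits act lo i (w[(l.1 : ℕ)]?.getD (0, false)) l.2

theorem reach_literal {n : ℕ} (w : List (ZMod g × Bool)) (hn : n ≤ w.length) (l : Fin n × Bool) :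
    Reach act lo (.lit i k s ok) ⟨ThreeCNF.encodeLiteral l ++ r, c, w, [], p, q, o⟩
      (afterLit i k (s || litFits act lo i w l) ok)
      ⟨r, (ThreeCNF.encodeLiteral l).reverse ++ c, w, [], p, q, o⟩
      (2 * (ThreeCNF.encodeLiteral l).length) := by
  obtain ⟨j, d⟩ := l
  have hj : (j : ℕ) < w.length := j.2.trans_le hn
  have hw : w.take j ++ w[(j : ℕ)] :: w.drop (j + 1) = w := by
    rw [List.getElem_cons_drop, List.take_append_drop]
  have hl : (w.take (j : ℕ)).length = j := by simp; omega
  have h₁ := reach_lit (act := act) (lo := lo) i k s ok r c p q o (w.take j) (w.drop (j + 1)) []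
    w[(j : ℕ)] d
  have h₂ := reach_ret (act := act) (lo := lo) i k (s || fits act lo i w[(j : ℕ)] d) ok r
    ((List.replicate j true ++ [false, d]).reverse ++ c) p q o
    (w[(j : ℕ)] :: w.drop (j + 1)) (w.take j).reverse
  rw [hw, hl] at h₁
  rw [List.append_nil] at h₁
  rw [List.reverse_reverse, hw, List.length_reverse, hl] at h₂
  have h := h₁.trans h₂
  have e : litFits act lo i w (j, d) = fits act lo i w[(j : ℕ)] d := by
    simp [litFits, List.getElem?_eq_getElem hj]
  rw [e]
  refine h.mono ?_
  simp [ThreeCNF.encodeLiteral]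
  omega

/-- The code of a clause. -/
def clauseCode {n : ℕ} (cl : Fin 3 → Fin n × Bool) : List Bool :=
  (List.finRange 3).flatMap fun k => ThreeCNF.encodeLiteral (cl k)

/-- Whether row `i` does not falsify the clause `cl` under the digits `w`. -/
def clauseFits (act : Fin R → ZMod g → Bool) (lo : Fin R → Bool) (i : Fin R)
    (w : List (ZMod g × Bool)) {n : ℕ} (cl : Fin 3 → Fin n × Bool) : Bool :=
  litFits act lo i w (cl 0) || litFits act lo i w (cl 1) || litFits act lo i w (cl 2)

theorem reach_clause {n : ℕ} (w : List (ZMod g × Bool)) (hn : n ≤ w.length)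
    (cl : Fin 3 → Fin n × Bool) :
    Reach act lo (.lit i 0 false ok) ⟨clauseCode cl ++ r, c, w, [], p, q, o⟩
      (.lit i 0 false (ok && clauseFits act lo i w cl))
      ⟨r, (clauseCode cl).reverse ++ c, w, [], p, q, o⟩ (2 * (clauseCode cl).length) := by
  have e : clauseCode cl = ThreeCNF.encodeLiteral (cl 0) ++ (ThreeCNF.encodeLiteral (cl 1) ++
      ThreeCNF.encodeLiteral (cl 2)) := by
    simp [clauseCode, List.finRange_succ]
  have h₀ := reach_literal (act := act) (lo := lo) i 0 false ok
    (ThreeCNF.encodeLiteral (cl 1) ++ (ThreeCNF.encodeLiteral (cl 2) ++ r)) c p q o w hn (cl 0)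
  have h₁ := reach_literal (act := act) (lo := lo) i 1 (false || litFits act lo i w (cl 0)) ok
    (ThreeCNF.encodeLiteral (cl 2) ++ r) ((ThreeCNF.encodeLiteral (cl 0)).reverse ++ c) p q o w hn
    (cl 1)
  have h₂ := reach_literal (act := act) (lo := lo) i 2
    ((false || litFits act lo i w (cl 0)) || litFits act lo i w (cl 1)) ok
    r ((ThreeCNF.encodeLiteral (cl 1)).reverse ++ ((ThreeCNF.encodeLiteral (cl 0)).reverse ++ c))
    p q o w hn (cl 2)
  have h := (h₀.trans h₁).trans h₂
  rw [e]
  simp only [List.append_assoc, List.reverse_append, List.length_append]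
  exact h.mono (by omega)

theorem reach_clauses {n : ℕ} (w : List (ZMod g × Bool)) (hn : n ≤ w.length)
    (cls : List (Fin 3 → Fin n × Bool)) :
    Reach act lo (.lit i 0 false ok) ⟨cls.flatMap clauseCode, c, w, [], p, q, o⟩
      (.lit i 0 false (ok && cls.all (clauseFits act lo i w)))
      ⟨[], (cls.flatMap clauseCode).reverse ++ c, w, [], p, q, o⟩
      (2 * (cls.flatMap clauseCode).length) := by
  induction cls generalizing ok c with
  | nil => simpa using Reach.refl
  | cons cl cls ih =>
    have h₁ := reach_clause (act := act) (lo := lo) i ok (cls.flatMap clauseCode) c p q o w hn cl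
    have h := h₁.trans (ih (ok && clauseFits act lo i w cl) ((clauseCode cl).reverse ++ c))
    simp only [List.flatMap_cons, List.all_cons, List.reverse_append, List.append_assoc,
      List.length_append, ← Bool.and_assoc]
    exact h.mono (by omega)

/-- The four bits written in the check column for the values `2 u` and `2 u + 1`. -/
def checkBits (ok : Bool) : List Bool := [ok, ok, true, true]

theorem reach_rewind (w X : List (ZMod g × Bool)) :
    Reach act lo (.rewind i ok) ⟨r, c, w, X, p, q, o⟩ (.inc i .check)
      ⟨c.reverse ++ r, [], w, X, p, q, (checkBits ok).reverse ++ o⟩ (c.length + 1) := by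
  induction c generalizing r with
  | nil =>
    refine Reach.single fun v => ?_
    simp [code, stepAux_write, checkBits]
  | cons y c ih =>
    refine Reach.head (fun v => ?_) (by simpa using ih (y :: r))
    simp [code, Reg.bit]

theorem reach_check {n : ℕ} (w : List (ZMod g × Bool)) (hn : n ≤ w.length)
    (cls : List (Fin 3 → Fin n × Bool)) :
    Reach act lo (.emit i .check) ⟨cls.flatMap clauseCode, [], w, [], p, q, o⟩
      (.inc i .check) ⟨cls.flatMap clauseCode, [], w, [], p, q,
        (checkBits (cls.all (clauseFits act lo i w))).reverse ++ o⟩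
      (3 * (cls.flatMap clauseCode).length + 3) := by
  have h₁ := reach_clauses (act := act) (lo := lo) i true [] p q o w hn cls
  have h₂ := reach_rewind (act := act) (lo := lo) i (cls.all (clauseFits act lo i w)) []
    (cls.flatMap clauseCode).reverse p q o w []
  rw [List.append_nil, Bool.true_and] at h₁
  rw [List.reverse_reverse, List.append_nil, List.length_reverse] at h₂
  refine (Reach.head (fun v => ?_) (h₁.trans (Reach.head (fun v => ?_) h₂))).mono ?_
  · simp [code]
  · simp [code]
  · omega

end check

/-! ### Binary counting through all partial assignments -/

section increment

variable (i : Fin R) (κ : Kind) (a b p q o : List Bool)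

/-- The place where the carry stops depends on `v`, so only the concatenation of the two stacks is
specified. The flag records whether the carry ran off the end, which happens exactly for the largest
value. -/
theorem reach_inc (G : List (ZMod g)) (X : List (ZMod g × Bool)) (v : ℕ)
    (hv : v < 2 ^ G.countP (act i)) :
    ∃ w' X' : List (ZMod g × Bool), X'.reverse ++ w' = X.reverse ++ digits (act i) G (v + 1) ∧
      X'.length ≤ X.length + G.length ∧
      Reach act lo (.inc i κ) ⟨a, b, digits (act i) G v, X, p, q, o⟩
        (.carry i κ (decide (v + 1 = 2 ^ G.countP (act i)))) ⟨a, b, w', X', p, q, o⟩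
        (G.length + 1) := by
  induction G generalizing X v with
  | nil =>
    obtain rfl : v = 0 := by simpa using hv
    refine ⟨[], X, by simp [digits], by simp, Reach.single fun v => ?_⟩
    simp [code, digits]
  | cons c G ih =>
    by_cases hc : act i c = true
    · rw [List.countP_cons_of_pos hc, pow_succ] at hv
      rcases Nat.even_or_odd' v with ⟨u, rfl | rfl⟩
      -- An even value: the lowest active digit becomes `true` and there is no carry. For an odd
      -- value it becomes `false` and the rest `u` is incremented.
      · refine ⟨(c, true) :: digits (act i) G u, X, ?_, by simp, ?_⟩
        · simp [digits, hc, show (2 * u + 1) / 2 = u by omega]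
        · have hne : ¬ (2 * u + 1 = 2 ^ (c :: G).countP (act i)) := by
            rw [List.countP_cons_of_pos hc, pow_succ]; omega
          rw [decide_eq_false hne]
          refine (Reach.single fun v => ?_).mono (Nat.le_add_left 1 _)
          simp [code, digits, hc, Reg.digit]
      · obtain ⟨w', X', h₁, h₂, h₃⟩ := ih ((c, false) :: X) u (by omega)
        refine ⟨w', X', ?_, ?_, ?_⟩
        · rw [h₁]
          simp [digits, hc, show (2 * u + 1 + 1) / 2 = u + 1 by omega,
            show (2 * u + 1 + 1) % 2 = 0 by omega]
        · simp at h₂ ⊢; omega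
        · have he : (u + 1 = 2 ^ G.countP (act i)) ↔
              (2 * u + 1 + 1 = 2 ^ (c :: G).countP (act i)) := by
            rw [List.countP_cons_of_pos hc, pow_succ]; omega
          rw [decide_eq_decide.2 he] at h₃
          refine Reach.head (fun v => ?_) h₃
          simp [code, digits, hc, Reg.digit, show (2 * u + 1) / 2 = u by omega]
    · rw [List.countP_cons_of_neg hc] at hv
      obtain ⟨w', X', h₁, h₂, h₃⟩ := ih ((c, false) :: X) v hv
      refine ⟨w', X', ?_, ?_, ?_⟩
      · rw [h₁]
        simp [digits, hc]
      · simp at h₂ ⊢; omega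
      · rw [List.countP_cons_of_neg hc]
        refine Reach.head (fun v => ?_) h₃
        simp [code, digits, hc, Reg.digit]

theorem reach_carry (w X : List (ZMod g × Bool)) (f : Bool) :
    Reach act lo (.carry i κ f) ⟨a, b, w, X, p, q, o⟩ (if f then .next i κ else .emit i κ)
      ⟨a, b, X.reverse ++ w, [], p, q, o⟩ (X.length + 1) := by
  induction X generalizing w with
  | nil =>
    refine Reach.single fun v => ?_
    simp [code]
  | cons y X ih =>
    refine Reach.head (fun v => ?_) (by simpa using ih (y :: w))
    simp [code, Reg.digit]

theorem reach_succ (G : List (ZMod g)) (v : ℕ) (hv : v < 2 ^ G.countP (act i)) :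
    Reach act lo (.inc i κ) ⟨a, b, digits (act i) G v, [], p, q, o⟩
      (if v + 1 = 2 ^ G.countP (act i) then .next i κ else .emit i κ)
      ⟨a, b, digits (act i) G (v + 1), [], p, q, o⟩ (2 * G.length + 2) := by
  obtain ⟨w', X', h₁, h₂, h₃⟩ := reach_inc (act := act) (lo := lo) i κ a b p q o G [] v hv
  have h₄ := reach_carry (act := act) (lo := lo) i κ a b p q o w' X'
    (decide (v + 1 = 2 ^ G.countP (act i)))
  rw [h₁] at h₄
  simp only [decide_eq_true_eq, List.reverse_nil, List.nil_append] at h₄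
  refine (h₃.trans h₄).mono ?_
  simp at h₂
  omega

/-- All values of the digits are run through. -/
theorem reach_enumerate (G : List (ZMod g)) (bits : ℕ → List Bool) (t : ℕ)
    (hbits : ∀ u < 2 ^ G.countP (act i), ∀ o : List Bool,
      Reach act lo (.emit i κ) ⟨a, b, digits (act i) G u, [], p, q, o⟩
        (.inc i κ) ⟨a, b, digits (act i) G u, [], p, q, (bits u).reverse ++ o⟩ t) :
    Reach act lo (.emit i κ) ⟨a, b, digits (act i) G 0, [], p, q, o⟩
      (.next i κ) ⟨a, b, digits (act i) G 0, [], p, q,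
        ((List.range (2 ^ G.countP (act i))).flatMap bits).reverse ++ o⟩
      (2 ^ G.countP (act i) * (t + (2 * G.length + 2))) := by
  have key : ∀ u < 2 ^ G.countP (act i),
      Reach act lo (.emit i κ) ⟨a, b, digits (act i) G 0, [], p, q, o⟩
        (if u + 1 = 2 ^ G.countP (act i) then .next i κ else .emit i κ)
        ⟨a, b, digits (act i) G (u + 1), [], p, q,
          ((List.range (u + 1)).flatMap bits).reverse ++ o⟩
        ((u + 1) * (t + (2 * G.length + 2))) := by
    intro u hu
    induction u with
    | zero =>
      simpa using (hbits 0 hu o).trans (reach_succ (act := act) (lo := lo) i κ a b p q _ G 0 hu)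
    | succ u ih =>
      have h := ih (by omega)
      rw [if_neg (by omega)] at h
      have h' := (h.trans (hbits (u + 1) hu _)).trans
        (reach_succ (act := act) (lo := lo) i κ a b p q _ G (u + 1) hu)
      rw [List.range_succ (n := u + 1), List.flatMap_append, List.reverse_append]
      simp only [List.flatMap_cons, List.flatMap_nil, List.append_nil, List.append_assoc]
      exact h'.mono (le_of_eq (by ring))
  have hpos : 0 < 2 ^ G.countP (act i) := by positivity
  have h := key (2 ^ G.countP (act i) - 1) (by omega)
  rw [Nat.sub_add_cancel hpos, if_pos rfl, digits_two_pow] at h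
  exact h

end increment

end GridWriter

/-! ### Writing rows and the whole encoding -/

namespace GridWriter

variable {g R : ℕ} (act : Fin R → ZMod g → Bool) (lo : Fin R → Bool)

section bits

variable (G : List (ZMod g)) {n : ℕ} (cls : List (Fin 3 → Fin n × Bool)) (i : Fin R)

/-- The cell of row `i` in the columns of position `j`. -/
def columnCell (j : ℕ) : List Bool :=
  (List.range (2 ^ G.countP (act i))).flatMap fun u =>
    columnBits act lo i ((digits (act i) G u)[j]?.getD (0, false))

/-- The cell of row `i` in the check column. -/
def checkCell : List Bool :=
  (List.range (2 ^ G.countP (act i))).flatMap fun u =>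
    checkBits (cls.all (clauseFits act lo i (digits (act i) G u)))

/-- Row `i` of the grid. -/
def rowBits : List Bool :=
  (List.range G.length).reverse.flatMap (columnCell act lo G i) ++ checkCell act lo G cls i ++
    (List.range G.length).flatMap (columnCell act lo G i)

/-- The whole output. -/
def gridBits (c : ℕ) : List Bool :=
  List.replicate R true ++ [false] ++ List.replicate (2 * G.length + 1) true ++ [false] ++
    List.replicate (2 * 2 ^ c) true ++ [false] ++
    (List.finRange R).flatMap (rowBits act lo G cls)

end bits

variable [NeZero R] {act lo}

section rows

variable (i : Fin R) (G : List (ZMod g)) {n : ℕ} (cls : List (Fin 3 → Fin n × Bool))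
  (a o : List Bool)

theorem reach_columnCell (κ : Kind) (hκ : κ = .first ∨ κ = .second) (j : ℕ) (hj : j < G.length)
    (q : List Bool) :
    Reach act lo (.emit i κ) ⟨a, [], digits (act i) G 0, [], List.replicate j true, q, o⟩
      (.next i κ) ⟨a, [], digits (act i) G 0, [], List.replicate j true, q,
        (columnCell act lo G i j).reverse ++ o⟩
      (2 ^ G.countP (act i) * (4 * G.length + 5)) := by
  refine (reach_enumerate i κ a [] (List.replicate j true) q o G _ (2 * j + 3) ?_).mono ?_
  · intro u _ o
    have hj' : j < (digits (act i) G u).length := by rwa [digits_length]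
    rw [List.getElem?_eq_getElem hj']
    exact reach_column i κ a [] q o hκ _ j hj'
  · gcongr 2 ^ _ * ?_
    omega

theorem reach_checkCell (hn : n ≤ G.length) (p q : List Bool) :
    Reach act lo (.emit i .check)
      ⟨cls.flatMap clauseCode, [], digits (act i) G 0, [], p, q, o⟩
      (.next i .check) ⟨cls.flatMap clauseCode, [], digits (act i) G 0, [], p, q,
        (checkCell act lo G cls i).reverse ++ o⟩
      (2 ^ G.countP (act i) * (3 * (cls.flatMap clauseCode).length + 2 * G.length + 5)) := by
  refine (reach_enumerate i .check _ [] p q o G _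
    (3 * (cls.flatMap clauseCode).length + 3) ?_).mono ?_
  · intro u _ o
    exact reach_check i p q o _ (by rwa [digits_length]) cls
  · gcongr 2 ^ _ * ?_
    omega

/-- Marks move from `p` to `q`, one per column, so the positions run downwards; in `reach_secondCol`
they move back and the positions run upwards. -/
theorem reach_firstCol (j k : ℕ) (hj : j ≤ G.length) :
    Reach act lo (.firstCol i)
      ⟨a, [], digits (act i) G 0, [], List.replicate j true, List.replicate k true, o⟩
      (.emit i .check)
      ⟨a, [], digits (act i) G 0, [], [], List.replicate (k + j) true,
        ((List.range j).reverse.flatMap (columnCell act lo G i)).reverse ++ o⟩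
      (j * (2 ^ G.countP (act i) * (4 * G.length + 5) + 2) + 1) := by
  induction j generalizing k o with
  | zero =>
    refine (Reach.single fun v => ?_).mono (by omega)
    simp [code]
  | succ j ih =>
    have h₁ := reach_columnCell (act := act) (lo := lo) i G a o .first (Or.inl rfl) j (by omega)
      (List.replicate (k + 1) true)
    have h₂ := ih ((columnCell act lo G i j).reverse ++ o) (k + 1) (by omega)
    rw [show k + 1 + j = k + (j + 1) by ring] at h₂
    rw [List.range_succ, List.reverse_append, List.flatMap_append, List.reverse_append]
    simp only [List.reverse_cons, List.reverse_nil, List.nil_append, List.flatMap_cons,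
      List.flatMap_nil, List.append_nil, List.append_assoc]
    refine (Reach.head (fun v => ?_) (h₁.trans (Reach.head (fun v => ?_) h₂))).mono
      (le_of_eq (by ring))
    · simp [code, List.replicate_succ]
    · simp [code]

theorem reach_secondCol (j k : ℕ) (hj : j + k ≤ G.length) :
    Reach act lo (.secondCol i)
      ⟨a, [], digits (act i) G 0, [], List.replicate j true, List.replicate k true, o⟩
      (.secondCol i)
      ⟨a, [], digits (act i) G 0, [], List.replicate (j + k) true, [],
        ((List.range' j k).flatMap (columnCell act lo G i)).reverse ++ o⟩
      (k * (2 ^ G.countP (act i) * (4 * G.length + 5) + 2)) := by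
  induction k generalizing j o with
  | zero => simpa using Reach.refl
  | succ k ih =>
    have h₁ := reach_columnCell (act := act) (lo := lo) i G a o .second (Or.inr rfl) j (by omega)
      (List.replicate k true)
    have h₂ := ih ((columnCell act lo G i j).reverse ++ o) (j + 1) (by omega)
    rw [show j + 1 + k = j + (k + 1) by ring] at h₂
    rw [List.range'_succ, List.flatMap_cons, List.reverse_append, List.append_assoc]
    refine (Reach.head (fun v => ?_) (h₁.trans (Reach.head (fun v => ?_) h₂))).mono
      (le_of_eq (by ring))
    · simp [code, List.replicate_succ]
    · simp [code, List.replicate_succ]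

/-- A bound on the number of steps in which a row is written. -/
def rowTime (c m L : ℕ) : ℕ := (2 * m + 1) * (2 ^ c * (3 * L + 4 * m + 5) + 2) + 2

theorem reach_row (hn : n ≤ G.length) :
    Reach act lo (.firstCol i)
      ⟨cls.flatMap clauseCode, [], digits (act i) G 0, [], List.replicate G.length true, [], o⟩
      (if h : i.1 + 1 < R then .firstCol ⟨i.1 + 1, h⟩ else .clean)
      ⟨cls.flatMap clauseCode, [], digits (act i) G 0, [], List.replicate G.length true, [],
        (rowBits act lo G cls i).reverse ++ o⟩
      (rowTime (G.countP (act i)) G.length (cls.flatMap clauseCode).length) := by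
  have h₁ := reach_firstCol (act := act) (lo := lo) i G (cls.flatMap clauseCode) o G.length 0 le_rfl
  have h₂ := reach_checkCell (act := act) (lo := lo) i G cls
    (((List.range G.length).reverse.flatMap (columnCell act lo G i)).reverse ++ o) hn []
    (List.replicate (0 + G.length) true)
  have h₃ := reach_secondCol (act := act) (lo := lo) i G (cls.flatMap clauseCode)
    ((checkCell act lo G cls i).reverse ++
      (((List.range G.length).reverse.flatMap (columnCell act lo G i)).reverse ++ o)) 0 G.length
    (by omega)
  rw [zero_add] at h₁ h₂ h₃
  have h₄ : Reach act lo (.secondCol i)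
      ⟨cls.flatMap clauseCode, [], digits (act i) G 0, [], List.replicate G.length true, [],
        ((List.range' 0 G.length).flatMap (columnCell act lo G i)).reverse ++
        ((checkCell act lo G cls i).reverse ++
      (((List.range G.length).reverse.flatMap (columnCell act lo G i)).reverse ++ o))⟩
      (if h : i.1 + 1 < R then .firstCol ⟨i.1 + 1, h⟩ else .clean)
      ⟨cls.flatMap clauseCode, [], digits (act i) G 0, [], List.replicate G.length true, [],
        (rowBits act lo G cls i).reverse ++ o⟩ 1 := by
    refine Reach.single fun v => ?_
    simp [code, rowBits, List.range_eq_range']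
  refine ((h₁.trans h₂).trans (Reach.head (fun v => ?_) (h₃.trans h₄))).mono ?_
  · simp [code]
  · have e₁ : 2 ^ G.countP (act i) * (4 * G.length + 5) ≤
        2 ^ G.countP (act i) * (3 * (cls.flatMap clauseCode).length + 4 * G.length + 5) := by
      gcongr; omega
    have e₂ : 2 ^ G.countP (act i) * (3 * (cls.flatMap clauseCode).length + 2 * G.length + 5) ≤
        2 ^ G.countP (act i) * (3 * (cls.flatMap clauseCode).length + 4 * G.length + 5) := by
      gcongr; omega
    have e₃ := Nat.mul_le_mul_left G.length e₁
    rw [rowTime]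
    nlinarith [e₁, e₂, e₃]

theorem reach_rows {c : ℕ} (hc : ∀ i, G.countP (act i) = c) (hn : n ≤ G.length) (d k : ℕ)
    (hd : k + d + 1 = R) :
    Reach act lo (.firstCol ⟨k, by omega⟩)
      ⟨cls.flatMap clauseCode, [], G.map fun x => (x, false), [], List.replicate G.length true, [],
        o⟩ .clean
      ⟨cls.flatMap clauseCode, [], G.map fun x => (x, false), [], List.replicate G.length true, [],
        (((List.finRange R).drop k).flatMap (rowBits act lo G cls)).reverse ++ o⟩
      ((d + 1) * rowTime c G.length (cls.flatMap clauseCode).length) := by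
  induction d generalizing k o with
  | zero =>
    have h := reach_row (act := act) (lo := lo) ⟨k, by omega⟩ G cls o hn
    rw [dif_neg (by simp; omega), hc, digits_zero] at h
    rw [List.drop_eq_getElem_cons (by simp; omega), List.drop_eq_nil_of_le (by simp; omega)]
    simpa using h
  | succ d ih =>
    have h := reach_row (act := act) (lo := lo) ⟨k, by omega⟩ G cls o hn
    rw [dif_pos (show k + 1 < R by omega), hc, digits_zero] at h
    have h' := h.trans (ih ((rowBits act lo G cls ⟨k, by omega⟩).reverse ++ o) (k + 1) (by omega))
    rw [List.drop_eq_getElem_cons (by simp; omega)]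
    simp only [List.getElem_finRange, List.flatMap_cons, List.reverse_append, List.append_assoc]
    exact h'.mono (le_of_eq (by ring))

end rows

/-! ### Reading and padding the variables, writing the header -/

section preparation

variable (a q o : List Bool)

theorem reach_read (n m : ℕ) :
    Reach act lo (.read (m : ZMod g))
      ⟨List.replicate n true ++ false :: a, [], (residues g m).map fun x => (x, false), [],
        List.replicate m true, q, o⟩
      (.pad ((m + n : ℕ) : ZMod g))
      ⟨a, [], (residues g (m + n)).map fun x => (x, false), [], List.replicate (m + n) true, q,
        List.replicate (2 * n) true ++ o⟩ (n + 1) := by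
  induction n generalizing m o with
  | zero =>
    refine Reach.single fun v => ?_
    simp [code, Reg.bit]
  | succ n ih =>
    have h := ih (true :: true :: o) (m + 1)
    rw [show m + 1 + n = m + (n + 1) by ring] at h
    have e : List.replicate (2 * n) true ++ true :: true :: o =
        List.replicate (2 * (n + 1)) true ++ o := by
      rw [show 2 * (n + 1) = 2 * n + 1 + 1 by ring, List.replicate_succ, List.replicate_succ,
        replicate_append_cons, replicate_append_cons]
      rfl
    rw [e] at h
    refine Reach.head (fun v => ?_) h
    simp [code, stepAux_write, Reg.bit, List.replicate_succ, residues]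

theorem reach_pad (m k n : ℕ) (hk : k < g) (hn : m + k = n) (hg : g ∣ n) :
    Reach act lo (.pad (m : ZMod g))
      ⟨a, [], (residues g m).map fun x => (x, false), [], List.replicate m true, q, o⟩
      (.emit 0 .header)
      ⟨a, [], (residues g n).map fun x => (x, false), [], List.replicate n true, q,
        false :: List.replicate (2 * k + 1) true ++ o⟩ (k + 1) := by
  induction k generalizing m o with
  | zero =>
    obtain rfl : m = n := by simpa using hn
    have h0 : (m : ZMod g) = 0 := (ZMod.natCast_eq_zero_iff m g).2 hg
    refine Reach.single fun v => ?_
    simp [code, stepAux_write, h0]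
  | succ k ih =>
    have h0 : (m : ZMod g) ≠ 0 := by
      intro h
      have h1 := (ZMod.natCast_eq_zero_iff m g).1 h
      have h2 : g ∣ k + 1 := (Nat.dvd_add_right h1).1 (hn ▸ hg)
      exact absurd (Nat.le_of_dvd (by omega) h2) (by omega)
    have h := ih (true :: true :: o) (m + 1) (by omega) (by omega)
    have e : List.replicate (2 * k + 1) true ++ true :: true :: o =
        List.replicate (2 * (k + 1) + 1) true ++ o := by
      rw [show 2 * (k + 1) + 1 = 2 * k + 1 + 1 + 1 by ring, replicate_append_cons,
        replicate_append_cons, List.replicate_succ (n := 2 * k + 1 + 1),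
        List.replicate_succ (n := 2 * k + 1)]
      rfl
    rw [List.cons_append, e] at h
    refine Reach.head (fun v => ?_) h
    simp [code, stepAux_write, h0, List.replicate_succ, residues]

theorem flatMap_range_const (m : ℕ) :
    (List.range m).flatMap (fun _ => [true, true]) = List.replicate (2 * m) true := by
  induction m with
  | zero => rfl
  | succ m ih =>
    rw [List.range_succ, List.flatMap_append, ih, show 2 * (m + 1) = 2 * m + 2 by ring,
      List.replicate_add]
    rfl

theorem reach_header (G : List (ZMod g)) (p : List Bool) (i : Fin R) :
    Reach act lo (.emit i .header) ⟨a, [], G.map fun x => (x, false), [], p, q, o⟩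
      (.firstCol i) ⟨a, [], G.map fun x => (x, false), [], p, q,
        false :: List.replicate (2 * 2 ^ G.countP (act i)) true ++ o⟩
      (2 ^ G.countP (act i) * (2 * G.length + 3) + 1) := by
  have h := reach_enumerate (act := act) (lo := lo) i .header a [] p q o G (fun _ => [true, true]) 1
    (fun u _ o => Reach.single fun v => by simp [code, stepAux_write])
  rw [flatMap_range_const, List.reverse_replicate, digits_zero] at h
  refine (h.trans (Reach.single fun v => ?_)).mono (le_of_eq (by ring))
  simp [code, stepAux_write]

end preparation

/-- A halting configuration must have all stacks but the output empty and the initial register; the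
last pops, from empty stacks, leave `none` in both parts of the register. -/
theorem runsIn_clean (a p o : List Bool) (w : List (ZMod g × Bool)) (v : Reg (ZMod g)) :
    RunsIn (TM2.step (code act lo)) ⟨some .clean, v, (Mem.mk a [] w [] p [] o).stk⟩
      ⟨none, (none, none), (Mem.mk [] [] [] [] [] [] o).stk⟩
      (a.length + p.length + w.length + 1) := by
  have head : ∀ {c : TM2.Cfg (alphabet (ZMod g)) (Lbl (ZMod g) (Fin R)) (Reg (ZMod g))}
      {v v' : Reg (ZMod g)} {m m' : Mem (ZMod g)} {t : ℕ},
      TM2.stepAux (code act lo .clean) v m.stk = ⟨some .clean, v', m'.stk⟩ →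
      RunsIn (TM2.step (code act lo)) ⟨some .clean, v', m'.stk⟩ c t →
      RunsIn (TM2.step (code act lo)) ⟨some .clean, v, m.stk⟩ c (t + 1) :=
    fun h h' => RunsIn.head (congrArg some h) h'
  induction a generalizing v with
  | cons x a ih =>
    refine (head ?_ (ih (some x, v.2))).mono ?_
    · simp [code]
    · simp only [List.length_cons]; omega
  | nil =>
    induction p generalizing v with
    | cons x p ih =>
      refine (head ?_ (ih (some x, v.2))).mono ?_
      · simp [code]
      · simp
    | nil =>
      induction w generalizing v with
      | cons x w ih =>
        refine (head ?_ (ih (none, some x))).mono ?_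
        · simp [code]
        · simp
      | nil =>
        refine RunsIn.single (congrArg some ?_)
        simp [code]

/-- The number of positions: the least multiple of `g` that is at least `n`. -/
def width (g n : ℕ) : ℕ := g * ((n + g - 1) / g)

theorem le_width [NeZero g] (n : ℕ) : n ≤ width g n ∧ width g n < n + g := by
  have hg := NeZero.pos g
  have h₁ := Nat.div_add_mod (n + g - 1) g
  have h₂ := Nat.mod_lt (n + g - 1) hg
  rw [width]
  omega

/-- A bound on the running time, for `n` variables, a formula of code length `L` and cells of
`2 ^ (c + 1)` values. -/
def writerTime (g R c n L : ℕ) : ℕ :=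
  (R + 1) * rowTime c (n + g) L + 4 * (n + g) + L + 10

theorem runsIn_machine [NeZero g] {c : ℕ} (φ : ThreeCNF)
    (hc : ∀ i, (residues g (width g φ.n)).countP (act i) = c) :
    RunsIn (machine act lo).step (initList (machine act lo) φ.encode)
      (haltList (machine act lo)
        (gridBits act lo (residues g (width g φ.n)) φ.clauses c).reverse)
      (writerTime g R c φ.n (φ.clauses.flatMap clauseCode).length) := by
  obtain ⟨hw₁, hw₂⟩ := le_width (g := g) φ.n
  set m := width g φ.n with hm
  have hdvd : g ∣ m := Dvd.intro _ rfl
  have hinit : initList (machine act lo) φ.encode =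
      (⟨some .start, (none, none), (Mem.mk φ.encode [] [] [] [] [] []).stk⟩ :
        TM2.Cfg (alphabet (ZMod g)) _ _) := by
    refine congrArg (TM2.Cfg.mk _ _) ?_
    refine (FinTM2.initList_stk (machine act lo) φ.encode).trans ?_
    refine Eq.trans ?_ (update_inp [] [] [] [] [] [] [] φ.encode)
    refine congrArg (fun S : ∀ k, List (alphabet (ZMod g) k) => Function.update S .inp φ.encode) ?_
    funext k; cases k <;> rfl
  have hhalt : ∀ l : List Bool, haltList (machine act lo) l =
      (⟨none, (none, none), (Mem.mk [] [] [] [] [] [] l).stk⟩ :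
        TM2.Cfg (alphabet (ZMod g)) (Lbl (ZMod g) (Fin R)) _) := by
    intro l
    refine congrArg (TM2.Cfg.mk _ _) ?_
    refine (FinTM2.haltList_stk (machine act lo) l).trans ?_
    refine Eq.trans ?_ (update_out [] [] [] [] [] [] [] l)
    refine congrArg (fun S : ∀ k, List (alphabet (ZMod g) k) => Function.update S .out l) ?_
    funext k; cases k <;> rfl
  rw [hinit, hhalt]
  have henc : φ.encode =
      List.replicate φ.n true ++ false :: φ.clauses.flatMap clauseCode := by
    simp only [ThreeCNF.encode, List.append_assoc, List.singleton_append]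
    rfl
  set a := φ.clauses.flatMap clauseCode with ha
  have h₁ := reach_read (act := act) (lo := lo) (g := g) a []
    (List.replicate R true ++ [false]).reverse φ.n 0
  have h₂ := reach_pad (act := act) (lo := lo) (g := g) a []
    (List.replicate (2 * φ.n) true ++ (List.replicate R true ++ [false]).reverse) φ.n (m - φ.n) m
    (by omega) (by omega) hdvd
  have h₃ := reach_header (act := act) (lo := lo) a [] (false :: List.replicate (2 * (m - φ.n) + 1)
    true ++ (List.replicate (2 * φ.n) true ++ (List.replicate R true ++ [false]).reverse))
    (residues g m) (List.replicate m true) 0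
  have hR := NeZero.pos R
  have h₄ := reach_rows (act := act) (lo := lo) (residues g m) φ.clauses
    (false :: List.replicate (2 * 2 ^ (residues g m).countP (act 0)) true ++
      (false :: List.replicate (2 * (m - φ.n) + 1) true ++ (List.replicate (2 * φ.n) true ++
      (List.replicate R true ++ [false]).reverse))) hc (by rwa [residues_length]) (R - 1) 0
      (by omega)
  rw [zero_add] at h₁
  simp only [residues_length] at h₃ h₄
  rw [hc] at h₃ h₄
  have hout : (((List.finRange R).drop 0).flatMap (rowBits act lo (residues g m)
      φ.clauses)).reverse ++ (false :: List.replicate (2 * 2 ^ c) true ++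
      (false :: List.replicate (2 * (m - φ.n) + 1) true ++ (List.replicate (2 * φ.n) true ++
      (List.replicate R true ++ [false]).reverse))) =
      (gridBits act lo (residues g m) φ.clauses c).reverse := by
    have e : List.replicate (2 * m + 1) true =
        List.replicate (2 * φ.n) true ++ List.replicate (2 * (m - φ.n) + 1) true := by
      rw [← List.replicate_add]; congr 1; omega
    simp only [gridBits, List.drop_zero, residues_length, e, List.reverse_append,
      List.reverse_replicate, List.reverse_cons, List.reverse_nil, List.nil_append,
      List.append_assoc, List.cons_append]
  rw [hout] at h₄
  have h₀ : Reach act lo .start ⟨φ.encode, [], [], [], [], [], []⟩ (.read 0)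
      ⟨φ.encode, [], [], [], [], [], (List.replicate R true ++ [false]).reverse⟩ 1 :=
    Reach.single fun v => by simp [code, stepAux_write]
  rw [henc] at h₀ ⊢
  rw [Nat.cast_zero] at h₁
  obtain ⟨v, h⟩ := ((((h₀.trans h₁).trans h₂).trans h₃).trans h₄) (none, none)
  refine (h.trans (runsIn_clean _ _ _ _ v)).mono ?_
  have e₁ : rowTime c m a.length ≤ rowTime c (φ.n + g) a.length := by
    rw [rowTime, rowTime]
    gcongr
  have e₂ : 2 ^ c * (2 * m + 3) ≤ rowTime c m a.length := by
    rw [rowTime]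
    nlinarith [Nat.zero_le (2 ^ c * m), Nat.zero_le (2 ^ c * a.length), Nat.zero_le (2 ^ c),
      Nat.zero_le (2 ^ c * m * m), Nat.zero_le (2 ^ c * m * a.length)]
  have e₃ := Nat.mul_le_mul_left R e₁
  rw [writerTime, Nat.sub_add_cancel hR]
  simp only [List.length_map, List.length_replicate, residues_length]
  rw [← ha, add_mul, one_mul]
  generalize R * rowTime c m a.length = x₁ at *
  generalize R * rowTime c (φ.n + g) a.length = x₂ at *
  generalize 2 ^ c * (2 * m + 3) = x₃ at *
  omega

end GridWriter

/-! ### Numbers with prescribed digits -/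

section value

variable {γ : Type} (act : γ → Bool)

/-- The number with the digit `A t` at every active position `t`. -/
def digitsValue : List γ → (ℕ → Bool) → ℕ
  | [], _ => 0
  | c :: G, A =>
    if act c then (A 0).toNat + 2 * digitsValue G (fun t => A (t + 1))
    else digitsValue G fun t => A (t + 1)

variable {act}

theorem digitsValue_lt (G : List γ) (A : ℕ → Bool) :
    digitsValue act G A < 2 ^ G.countP act := by
  induction G generalizing A with
  | nil => simp [digitsValue]
  | cons c G ih =>
    have h := ih fun t => A (t + 1)
    by_cases hc : act c = true
    · have h0 := Bool.toNat_le (A 0)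
      rw [List.countP_cons_of_pos hc, pow_succ, digitsValue, if_pos hc]
      omega
    · rwa [List.countP_cons_of_neg hc, digitsValue, if_neg hc]

/-- Complementing all digits reverses the order of numbers; this turns the inequality from the
companion row into the missing one. -/
theorem digitsValue_not (G : List γ) (A : ℕ → Bool) :
    digitsValue act G A + digitsValue act G (fun t => !A t) + 1 = 2 ^ G.countP act := by
  induction G generalizing A with
  | nil => simp [digitsValue]
  | cons c G ih =>
    have h := ih fun t => A (t + 1)
    by_cases hc : act c = true
    · have h0 : (A 0).toNat + (!A 0).toNat = 1 := by cases A 0 <;> rfl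
      rw [List.countP_cons_of_pos hc, pow_succ, digitsValue, if_pos hc, digitsValue, if_pos hc]
      omega
    · rwa [List.countP_cons_of_neg hc, digitsValue, if_neg hc, digitsValue, if_neg hc]

theorem getElem?_digits_digitsValue (G : List γ) (A : ℕ → Bool) (t : ℕ) :
    (digits act G (digitsValue act G A))[t]? = G[t]?.map fun c => (c, act c && A t) := by
  induction G generalizing A t with
  | nil => simp [digits]
  | cons c G ih =>
    by_cases hc : act c = true
    · have h1 : ((A 0).toNat + 2 * digitsValue act G fun t => A (t + 1)) / 2 =
          digitsValue act G fun t => A (t + 1) := by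
        have := Bool.toNat_lt (A 0); omega
      have h2 : ((A 0).toNat + 2 * digitsValue act G fun t => A (t + 1)) % 2 = (A 0).toNat := by
        have := Bool.toNat_lt (A 0); omega
      rw [digitsValue, if_pos hc, digits, if_pos hc, h1, h2]
      cases t with
      | zero => simp [hc]
      | succ t => simpa using ih _ t
    · rw [digitsValue, if_neg hc, digits, if_neg hc]
      cases t with
      | zero => simp [hc]
      | succ t => simpa using ih _ t

theorem map_fst_getElem?_digits (G : List γ) (v t : ℕ) :
    (digits act G v)[t]?.map Prod.fst = G[t]? := by
  induction G generalizing v t with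
  | nil => simp [digits]
  | cons c G ih =>
    rw [digits]
    split <;> cases t <;> simp [ih]

/-- Each `u t` is only known to have the right digit at position `t`. Shifting the sequence and, at
an active position, halving it removes the lowest digit and keeps monotonicity. By induction the
higher part of the number is at most `u 1 / 2 ≤ u 0 / 2`, and the lowest digits agree. -/
theorem digitsValue_le (G : List γ) (A : ℕ → Bool) (u : ℕ → ℕ) (hu : ∀ t, u (t + 1) ≤ u t)
    (hd : ∀ t c, G[t]? = some c → act c = true → (digits act G (u t))[t]? = some (c, A t)) :
    digitsValue act G A ≤ u 0 := by
  induction G generalizing A u with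
  | nil => simp [digitsValue]
  | cons c G ih =>
    by_cases hc : act c = true
    · have h := ih (fun t => A (t + 1)) (fun t => u (t + 1) / 2)
        (fun t => Nat.div_le_div_right (hu (t + 1))) fun t c' h1 h2 => by
          simpa [digits, hc] using hd (t + 1) c' (by simpa using h1) h2
      have h0 : decide (u 0 % 2 = 1) = A 0 := by simpa [digits, hc] using hd 0 c (by simp) hc
      have h1 : (A 0).toNat = u 0 % 2 := by
        rw [← h0]
        rcases Nat.mod_two_eq_zero_or_one (u 0) with h | h <;> simp [h]
      have h2 := hu 0
      simp only [zero_add] at h h2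
      rw [digitsValue, if_pos hc]
      omega
    · have h := ih (fun t => A (t + 1)) (fun t => u (t + 1)) (fun t => hu (t + 1))
        fun t c' h1 h2 => by
          simpa [digits, hc] using hd (t + 1) c' (by simpa using h1) h2
      rw [digitsValue, if_neg hc]
      exact h.trans (hu 0)

/-- The mirror image of `digitsValue_le`. The bound on `u` is needed at the end of the induction,
where no active digit is left and `u 0` has to be `0`. -/
theorem le_digitsValue (G : List γ) (A : ℕ → Bool) (u : ℕ → ℕ) (hu : ∀ t, u t ≤ u (t + 1))
    (hlt : ∀ t, u t < 2 ^ G.countP act)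
    (hd : ∀ t c, G[t]? = some c → act c = true → (digits act G (u t))[t]? = some (c, A t)) :
    u 0 ≤ digitsValue act G A := by
  induction G generalizing A u with
  | nil => exact (Nat.lt_one_iff.1 (by simpa using hlt 0)).le
  | cons c G ih =>
    by_cases hc : act c = true
    · rw [List.countP_cons_of_pos hc, pow_succ] at hlt
      have h := ih (fun t => A (t + 1)) (fun t => u (t + 1) / 2)
        (fun t => Nat.div_le_div_right (hu (t + 1)))
        (fun t => by have := hlt (t + 1); omega) fun t c' h1 h2 => by
          simpa [digits, hc] using hd (t + 1) c' (by simpa using h1) h2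
      have h0 : decide (u 0 % 2 = 1) = A 0 := by simpa [digits, hc] using hd 0 c (by simp) hc
      have h1 : (A 0).toNat = u 0 % 2 := by
        rw [← h0]
        rcases Nat.mod_two_eq_zero_or_one (u 0) with h | h <;> simp [h]
      have h2 := hu 0
      simp only [zero_add] at h h2
      rw [digitsValue, if_pos hc]
      omega
    · rw [List.countP_cons_of_neg hc] at hlt
      have h := ih (fun t => A (t + 1)) (fun t => u (t + 1)) (fun t => hu (t + 1))
        (fun t => hlt (t + 1)) fun t c' h1 h2 => by
          simpa [digits, hc] using hd (t + 1) c' (by simpa using h1) h2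
      rw [digitsValue, if_neg hc]
      exact (hu 0).trans h

end value

/-! ### The grid -/

namespace GridWriter

variable {g R : ℕ} (act : Fin R → ZMod g → Bool) (lo : Fin R → Bool)

section cells

variable (G : List (ZMod g)) {n : ℕ} (cls : List (Fin 3 → Fin n × Bool)) (i : Fin R)

/-- The position of the column `j`, or `none` for the check column. -/
def columnPos (m j : ℕ) : Option ℕ :=
  if j < m then some (m - 1 - j) else if j = m then none else some (j - (m + 1))

/-- Whether the pair `(a, v)` belongs to the cell of row `i` in a column of the given position. -/
def cellMem : Option ℕ → Bool → ℕ → Bool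
  -- Odd values are fillers: they keep the check cell non-empty even if no partial assignment
  -- passes. The variable columns contain only even values, and this will exclude the fillers.
  | none, _, v => v % 2 == 1 || cls.all (clauseFits act lo i (digits (act i) G (v / 2)))
  | some t, a, v =>
    v % 2 == 0 && fits act lo i ((digits (act i) G (v / 2))[t]?.getD (0, false)) a

/-- The code of a cell. -/
def cellCode (j : Option ℕ) : List Bool :=
  (List.range (2 * 2 ^ G.countP (act i))).flatMap fun v =>
    [cellMem act lo G cls i j false v, cellMem act lo G cls i j true v]

theorem flatMap_range_two_mul {α : Type*} (m : ℕ) (f : ℕ → List α) :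
    (List.range (2 * m)).flatMap f =
      (List.range m).flatMap fun u => f (2 * u) ++ f (2 * u + 1) := by
  induction m with
  | zero => rfl
  | succ m ih =>
    rw [show 2 * (m + 1) = 2 * m + 1 + 1 by ring, List.range_succ, List.range_succ,
      List.range_succ, List.flatMap_append, List.flatMap_append, List.flatMap_append, ih]
    simp

theorem cellCode_some (t : ℕ) :
    cellCode act lo G cls i (some t) = columnCell act lo G i t := by
  rw [cellCode, flatMap_range_two_mul, columnCell]
  refine congrArg (fun f => List.flatMap f _) (funext fun u => ?_)
  simp [cellMem, columnBits, show (2 * u + 1) % 2 = 1 by omega]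

theorem cellCode_none : cellCode act lo G cls i none = checkCell act lo G cls i := by
  rw [cellCode, flatMap_range_two_mul, checkCell]
  refine congrArg (fun f => List.flatMap f _) (funext fun u => ?_)
  simp [cellMem, checkBits, show (2 * u + 1) % 2 = 1 by omega]

theorem flatMap_columnPos {α : Type*} (m : ℕ) (f : Option ℕ → List α) :
    (List.range (2 * m + 1)).flatMap (fun j => f (columnPos m j)) =
      (List.range m).reverse.flatMap (fun t => f (some t)) ++ f none ++
        (List.range m).flatMap fun t => f (some t) := by
  have h₁ : (List.range m).map (columnPos m) = (List.range m).reverse.map some := by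
    refine List.ext_getElem (by simp) fun j h _ => ?_
    have hj : j < m := by simpa using h
    simp [columnPos, hj]
  have h₂ : (List.range m).map (fun t => columnPos m (m + 1 + t)) = (List.range m).map some := by
    refine List.map_congr_left fun t _ => ?_
    rw [columnPos, if_neg (by omega), if_neg (by omega)]
    congr 1
    omega
  have h₃ : columnPos m m = none := by simp [columnPos]
  rw [show 2 * m + 1 = m + 1 + m by ring, List.range_add, List.range_succ, List.flatMap_append,
    List.flatMap_append, List.flatMap_cons, List.flatMap_nil, List.append_nil, h₃]
  congr 1
  · congr 1
    rw [← List.flatMap_map (f := columnPos m) (g := f), h₁, List.flatMap_map]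
  · rw [List.flatMap_map, ← List.flatMap_map (f := fun t => columnPos m (m + 1 + t)) (g := f), h₂,
      List.flatMap_map]

theorem flatMap_cellCode :
    (List.range (2 * G.length + 1)).flatMap
      (fun j => cellCode act lo G cls i (columnPos G.length j)) = rowBits act lo G cls i := by
  rw [flatMap_columnPos, cellCode_none, rowBits]
  simp only [cellCode_some]

end cells

/-- The grid of a formula. -/
def grid [NeZero R] (φ : ThreeCNF) (c : ℕ) : GridTilingInstance where
  x := R
  y := 2 * width g φ.n + 1
  N := 2 * 2 ^ c
  x_pos := NeZero.pos R
  y_pos := Nat.succ_pos _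
  S i j := Finset.univ.filter fun e =>
    cellMem act lo (residues g (width g φ.n)) φ.clauses i (columnPos (width g φ.n) j) e.1 e.2
  S_nonempty i j := by
    have h2 : 1 < 2 * 2 ^ c := by have : 0 < 2 ^ c := by positivity
                                  omega
    rcases h : columnPos (width g φ.n) j with _ | t
    · exact ⟨(false, ⟨1, h2⟩), Finset.mem_filter.2 ⟨Finset.mem_univ _, rfl⟩⟩
    -- All digits of `0` are `false`, which in row `i` stands for the value `lo i`.
    · refine ⟨(lo i, ⟨0, by omega⟩), Finset.mem_filter.2 ⟨Finset.mem_univ _, ?_⟩⟩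
      simp only [cellMem, digits_zero, Nat.zero_div, fits, List.getElem?_map]
      rcases h' : (residues g (width g φ.n))[t]? with _ | x <;> simp

variable {act lo} in
theorem mem_grid [NeZero R] {φ : ThreeCNF} {c : ℕ} (i : Fin R) (j : Fin (2 * width g φ.n + 1))
    (e : Bool × Fin (2 * 2 ^ c)) :
    e ∈ (grid act lo φ c).S i j ↔ cellMem act lo (residues g (width g φ.n)) φ.clauses i
      (columnPos (width g φ.n) j) e.1 e.2 = true :=
  Finset.mem_filter.trans (and_iff_right (Finset.mem_univ _))

theorem flatMap_finRange {α : Type*} (m : ℕ) (f : ℕ → List α) :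
    ((List.finRange m).flatMap fun j => f j.1) = (List.range m).flatMap f := by
  have h : List.range m = (List.finRange m).map Fin.val :=
    List.ext_getElem (by simp) (by simp)
  rw [h, List.flatMap_map]

theorem encode_grid [NeZero R] (φ : ThreeCNF) (c : ℕ)
    (hc : ∀ i, (residues g (width g φ.n)).countP (act i) = c) :
    (grid act lo φ c).encode = gridBits act lo (residues g (width g φ.n)) φ.clauses c := by
  have key : ∀ i : Fin R, ((List.finRange (grid act lo φ c).y).flatMap fun j =>
      (List.finRange (grid act lo φ c).N).flatMap fun v =>
        [decide ((false, v) ∈ (grid act lo φ c).S i j),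
          decide ((true, v) ∈ (grid act lo φ c).S i j)]) =
      rowBits act lo (residues g (width g φ.n)) φ.clauses i := by
    intro i
    rw [← flatMap_cellCode, residues_length, ← flatMap_finRange]
    refine congrArg (fun f => List.flatMap f _) (funext fun j => ?_)
    rw [cellCode, hc, ← flatMap_finRange]
    refine congrArg (fun f => List.flatMap f _) (funext fun v => ?_)
    have h : ∀ a : Bool, decide ((a, v) ∈ (grid act lo φ c).S i j) = cellMem act lo
        (residues g (width g φ.n)) φ.clauses i (columnPos (width g φ.n) j) a v := fun a =>
      Bool.eq_iff_iff.2 (decide_eq_true_iff.trans (mem_grid i j _))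
    exact congrArg₂ (fun x y => [x, y]) (h false) (h true)
  rw [GridTilingInstance.encode, gridBits, residues_length]
  refine congrArg₂ _ rfl ?_
  exact congrArg (fun f => List.flatMap f _) (funext key)

/-! ### Correctness of the reduction -/

theorem clauseFits_iff (i : Fin R) (w : List (ZMod g × Bool)) {n : ℕ} (cl : Fin 3 → Fin n × Bool) :
    clauseFits act lo i w cl = true ↔ ∃ k, litFits act lo i w (cl k) = true := by
  simp [clauseFits, Fin.exists_fin_succ, or_assoc]

variable {act lo}

theorem monotoneSolvable_grid [NeZero g] [NeZero R] {φ : ThreeCNF} {c : ℕ}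
    (hc : ∀ i, (residues g (width g φ.n)).countP (act i) = c) (h : φ.Satisfiable) :
    (grid act lo φ c).MonotoneSolvable := by
  obtain ⟨A₀, hA₀⟩ := h
  set G := residues g (width g φ.n) with hG
  let A : ℕ → Bool := fun t => if h : t < φ.n then A₀ ⟨t, h⟩ else false
  let u : Fin R → ℕ := fun i => digitsValue (act i) G fun t => xor (A t) (lo i)
  have hu : ∀ i, 2 * u i < 2 * 2 ^ c := fun i => by
    have := digitsValue_lt (act := act i) G fun t => xor (A t) (lo i)
    rw [hc] at this
    change 2 * digitsValue (act i) G _ < _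
    omega
  have hdig : ∀ i t a, A t = a →
      fits act lo i ((digits (act i) G (2 * u i / 2))[t]?.getD (0, false)) a = true ∨
        G[t]? = none := by
    intro i t a ha
    rw [Nat.mul_div_cancel_left _ two_pos, getElem?_digits_digitsValue]
    rcases G[t]? with _ | p
    · exact Or.inr rfl
    · left
      subst ha
      simp only [fits, Option.map_some, Option.getD_some]
      cases act i p <;> simp
  -- Rows are constant in the second component, columns in the first. The check column ignores its
  -- first component, so `false` is an arbitrary choice.
  refine ⟨fun i j => (((columnPos (width g φ.n) j).map A).getD false, ⟨2 * u i, hu i⟩), ?_, ?_, ?_⟩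
  · intro (i : Fin R) (j : Fin (2 * width g φ.n + 1))
    refine (mem_grid (act := act) (lo := lo) i j _).2 ?_
    change cellMem act lo G φ.clauses i _ (((columnPos (width g φ.n) j).map A).getD false)
      (2 * u i) = true
    rcases h : columnPos (width g φ.n) j with _ | t
    · simp only [cellMem, Bool.or_eq_true, List.all_eq_true]
      right
      intro cl hcl
      rw [clauseFits_iff]
      obtain ⟨k, hk⟩ := hA₀ cl hcl
      refine ⟨k, ?_⟩
      have hk' : A (cl k).1 = (cl k).2 := by simpa [A] using hk
      refine (hdig i _ _ hk').resolve_right ?_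
      have : ((cl k).1 : ℕ) < G.length := by
        rw [hG, residues_length]; exact (cl k).1.2.trans_le (le_width _).1
      simp [this]
    · simp only [cellMem, Option.map_some, Option.getD_some, Bool.and_eq_true]
      refine ⟨by simp, (hdig i t _ rfl).resolve_right ?_⟩
      have hj : (j : ℕ) < 2 * width g φ.n + 1 := j.2
      have : t < G.length := by
        rw [hG, residues_length]
        simp only [columnPos] at h
        split_ifs at h <;> simp at h <;> omega
      simp [this]
  · intro i i' j _
    rfl
  · intro i j j' _
    exact le_rfl

/-- For each clause, `hcover` provides a row and its companion in which all three variables are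
active. The two rows together pin the check entry to the assignment read off the left half. -/
theorem satisfiable_of_monotoneSolvable_grid [NeZero g] [NeZero R] {φ : ThreeCNF} {c : ℕ}
    (hc : ∀ i, (residues g (width g φ.n)).countP (act i) = c)
    (hcover : ∀ f : Fin 3 → ZMod g, ∃ i i', act i' = act i ∧ lo i = false ∧ lo i' = true ∧
      ∀ k, act i (f k) = true)
    (h : (grid act lo φ c).MonotoneSolvable) : φ.Satisfiable := by
  obtain ⟨s, hmem, hcol, hrow⟩ := h
  have hw := (le_width (g := g) φ.n).1
  set m := width g φ.n with hm
  set G := residues g m with hG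
  have hGl : G.length = m := residues_length g m
  change ∀ (i : Fin R) (j : Fin (2 * m + 1)), _ at hmem
  -- the chosen entries, with the column clamped to the grid
  let e : Fin R → ℕ → Bool × Fin (2 * 2 ^ c) := fun i j => s i ⟨min j (2 * m), by
    change _ < 2 * m + 1; omega⟩
  let B : Fin R → ℕ → ℕ := fun i j => (e i j).2
  have hB : ∀ i j, B i j / 2 < 2 ^ c := fun i j => by
    have := (e i j).2.2
    change (e i j).2.1 / 2 < _
    omega
  have hcolumn : ∀ (i : Fin R) j, (e i j).1 = (e 0 j).1 := by
    intro i j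
    obtain ⟨k, hk⟩ := i
    induction k with
    | zero => rfl
    | succ k ih =>
      exact (hcol (⟨k, Nat.lt_of_succ_lt hk⟩ : Fin R) (⟨k + 1, hk⟩ : Fin R) _ rfl).symm.trans
        (ih (Nat.lt_of_succ_lt hk))
  have hmono : ∀ i, Monotone (B i) := fun i => monotone_nat_of_le_succ fun j => by
    by_cases hj : j + 1 ≤ 2 * m
    · refine hrow i _ _ ?_
      simp only [min_eq_left hj, min_eq_left (Nat.le_of_succ_le hj)]
    · have : min (j + 1) (2 * m) = min j (2 * m) := by omega
      simp only [B, e, this, le_refl]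
  have hcell : ∀ i j, j ≤ 2 * m →
      cellMem act lo G φ.clauses i (columnPos m j) (e 0 j).1 (B i j) = true := by
    intro i j hj
    have h := hmem i ⟨min j (2 * m), by omega⟩
    have h' := (mem_grid (act := act) (lo := lo) i ⟨min j (2 * m), by omega⟩ _).1 h
    rw [← hcolumn i j]
    change cellMem act lo G φ.clauses i (columnPos m (min j (2 * m))) (e i j).1 (B i j) = true at h'
    rwa [min_eq_left hj] at h'
  let A : ℕ → Bool := fun t => (e 0 (m - 1 - t)).1
  let A' : ℕ → Bool := fun t => (e 0 (m + 1 + t)).1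
  have hdigit : ∀ i j t p, j ≤ 2 * m → columnPos m j = some t → G[t]? = some p →
      act i p = true →
      (digits (act i) G (B i j / 2))[t]? = some (p, xor (e 0 j).1 (lo i)) ∧ B i j % 2 = 0 := by
    intro i j t p hj hjt hp hact
    have h := hcell i j hj
    have h1 := map_fst_getElem?_digits (act := act i) G (B i j / 2) t
    rw [hp] at h1
    obtain ⟨⟨p', d⟩, h2, h3⟩ := Option.map_eq_some_iff.1 h1
    obtain rfl : p' = p := h3
    rw [hjt, cellMem, h2] at h
    simp only [Option.getD_some, fits, hact, Bool.not_true, Bool.false_or, Bool.and_eq_true,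
      beq_iff_eq] at h
    refine ⟨?_, h.1⟩
    rw [h2, h.2]
    simp
  have hlower : ∀ i, 0 < m → digitsValue (act i) G (fun t => xor (A t) (lo i)) ≤ B i m / 2 := by
    intro i hm0
    refine (digitsValue_le G _ (fun t => B i (m - 1 - t) / 2)
      (fun t => Nat.div_le_div_right (hmono i (by omega))) ?_).trans
      (Nat.div_le_div_right (hmono i (by omega)))
    intro t p hp hact
    have ht : t < m := by
      rw [← hGl]; exact (List.getElem?_eq_some_iff.1 hp).1
    refine (hdigit i (m - 1 - t) t p (by omega) ?_ hp hact).1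
    rw [columnPos, if_pos (by omega)]
    congr 1; omega
  have hupper : ∀ i, B i (m + 1) / 2 ≤ digitsValue (act i) G (fun t => xor (A' t) (lo i)) := by
    intro i
    refine le_digitsValue G _ (fun t => B i (m + 1 + t) / 2)
      (fun t => Nat.div_le_div_right (hmono i (by omega))) (fun t => by rw [hc]; exact hB _ _) ?_
    intro t p hp hact
    have ht : t < m := by
      rw [← hGl]; exact (List.getElem?_eq_some_iff.1 hp).1
    refine (hdigit i (m + 1 + t) t p (by omega) ?_ hp hact).1
    rw [columnPos, if_neg (by omega), if_neg (by omega)]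
    congr 1; omega
  have heven : ∀ i, 0 < m → B i (m + 1) % 2 = 0 := by
    intro i hm0
    have h := hcell i (m + 1) (by omega)
    rw [columnPos, if_neg (by omega), if_neg (by omega), cellMem] at h
    simpa using (Bool.and_eq_true_iff.1 h).1
  refine ⟨fun t => A t, fun cl hcl => ?_⟩
  have hm0 : 0 < m := by have := (cl 0).1.2; omega
  have hlt : ∀ k, ((cl k).1 : ℕ) < G.length := fun k => by
    rw [hGl]; exact (cl k).1.2.trans_le hw
  obtain ⟨i, i', hact, hi, hi', hf⟩ := hcover fun k => G[((cl k).1 : ℕ)]'(hlt k)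
  have h₁ := hlower i hm0
  have h₂ := hlower i' hm0
  have h₃ := hupper i
  have h₄ := hupper i'
  simp only [hact, hi, hi', Bool.xor_false, Bool.xor_true] at h₁ h₂ h₃ h₄
  change digitsValue (act i) G A ≤ _ at h₁
  change _ ≤ digitsValue (act i) G A' at h₃
  have h₅ := digitsValue_not (act := act i) G A
  have h₆ := digitsValue_not (act := act i) G A'
  have h₇ := heven i hm0
  have h₈ : B i m ≤ B i (m + 1) := hmono i (Nat.le_succ m)
  have h₉ : B i' m ≤ B i' (m + 1) := hmono i' (Nat.le_succ m)
  -- Row `i'` yields that `A'` is at most `A` as a number, so `A ≤ B i m / 2 ≤ B i (m + 1) / 2 ≤ A'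
  -- ≤ A`. As `B i (m + 1)` is even, `B i m` cannot be the odd filler.
  have hval : B i m / 2 = digitsValue (act i) G A ∧ B i m % 2 = 0 := by omega
  have hchk := hcell i m (by omega)
  rw [show columnPos m m = none by simp [columnPos], cellMem, hval.1, hval.2] at hchk
  simp only [Nat.zero_ne_one, beq_iff_eq, Bool.or_eq_true, false_or, List.all_eq_true] at hchk
  obtain ⟨k, hk⟩ := (clauseFits_iff act lo i _ cl).1 (hchk cl hcl)
  refine ⟨k, ?_⟩
  have hfk : act i (G[((cl k).1 : ℕ)]'(hlt k)) = true := hf k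
  rw [litFits, getElem?_digits_digitsValue, List.getElem?_eq_getElem (hlt k)] at hk
  simp only [Option.map_some, Option.getD_some, fits, hfk, hi, Bool.not_true, Bool.false_or,
    Bool.true_and, Bool.xor_false, beq_iff_eq] at hk
  exact hk.symm

end GridWriter

namespace GridWriter

/-! ### The rows of the grid -/

theorem countP_residues {g : ℕ} (p : ZMod g → Bool) (m : ℕ) :
    (residues g m).countP p = Nat.count (fun t : ℕ => p t = true) m := by
  induction m with
  | zero => rfl
  | succ m ih => rw [residues, List.countP_cons, ih, Nat.count_succ]

/-- Every block of `g` consecutive positions meets each class once. -/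
theorem countP_residues_mul {g : ℕ} [NeZero g] (T : Finset (ZMod g)) (h : ℕ) :
    (residues g (g * h)).countP (fun x => decide (x ∈ T)) = T.card * h := by
  have h₁ : Nat.count (fun t : ℕ => decide ((t : ZMod g) ∈ T) = true) g = T.card := by
    rw [Nat.count_eq_card_filter_range]
    refine Finset.card_nbij' (fun t : ℕ => (t : ZMod g)) ZMod.val ?_ ?_ ?_ ?_
    · intro t ht
      simpa using (Finset.mem_filter.1 ht).2
    · intro x hx
      simpa [ZMod.val_lt] using hx
    · intro t ht
      exact ZMod.val_cast_of_lt (by simpa using (Finset.mem_filter.1 ht).1)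
    · intro x _
      exact ZMod.natCast_rightInverse x
  rw [countP_residues]
  induction h with
  | zero => simp
  | succ h ih =>
    rw [Nat.mul_succ, Nat.count_add, ih]
    simp only [Nat.cast_add, Nat.cast_mul, CharP.cast_eq_zero, zero_mul, zero_add]
    rw [h₁, Nat.mul_succ]

/-- Rows are indexed by pairs of a 3-element set of classes and a sign. The classes of a clause may
coincide, so they are enlarged to a set of exactly three, which needs `3 ≤ g`. -/
theorem exists_rows (g : ℕ) [NeZero g] (hg : 3 ≤ g) :
    ∃ (R : ℕ) (_ : NeZero R) (act : Fin R → ZMod g → Bool) (lo : Fin R → Bool),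
      (∀ i h, (residues g (g * h)).countP (act i) = 3 * h) ∧
      ∀ f : Fin 3 → ZMod g, ∃ i i', act i' = act i ∧ lo i = false ∧ lo i' = true ∧
        ∀ k, act i (f k) = true := by
  classical
  have := ZMod.fintype g
  let ρ := {T : Finset (ZMod g) // T.card = 3} × Bool
  have hex : ∀ f : Fin 3 → ZMod g, ∃ T : Finset (ZMod g), Finset.univ.image f ⊆ T ∧ T.card = 3 :=
    fun f => Finset.exists_superset_card_eq
      (Finset.card_image_le.trans (by simp)) (by rw [ZMod.card]; exact hg)
  obtain ⟨T₀, -, hT₀⟩ := hex fun _ => 0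
  have : Nonempty ρ := ⟨(⟨T₀, hT₀⟩, false)⟩
  let e : Fin (Fintype.card ρ) ≃ ρ := (Fintype.equivFin ρ).symm
  refine ⟨Fintype.card ρ, ⟨Fintype.card_ne_zero⟩, fun i x => decide (x ∈ (e i).1.1),
    fun i => (e i).2, fun i h => ?_, fun f => ?_⟩
  · rw [countP_residues_mul, (e i).1.2]
  · obtain ⟨T, hfT, hT⟩ := hex f
    refine ⟨e.symm (⟨T, hT⟩, false), e.symm (⟨T, hT⟩, true), ?_, ?_, ?_, fun k => ?_⟩
    · simp
    · simp
    · simp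
    · simpa using hfT (Finset.mem_image_of_mem f (Finset.mem_univ k))

/-! ### Sizes -/

theorem length_clauseCode_le {n : ℕ} (cl : Fin 3 → Fin n × Bool) :
    (clauseCode cl).length ≤ 3 * (n + 1) := by
  have h : ∀ k, (ThreeCNF.encodeLiteral (cl k)).length ≤ n + 1 := fun k => by
    simp [ThreeCNF.encodeLiteral]
  have e : clauseCode cl = ThreeCNF.encodeLiteral (cl 0) ++ (ThreeCNF.encodeLiteral (cl 1) ++
      ThreeCNF.encodeLiteral (cl 2)) := by
    simp [clauseCode, List.finRange_succ]
  have h₀ := h 0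
  have h₁ := h 1
  have h₂ := h 2
  rw [e]
  simp only [List.length_append]
  omega

/-- Distinctness of the clauses enters here: there are at most `(2 n) ^ 3` of them, so the running
time can be bounded in terms of `n` alone. -/
theorem length_clauses_le (φ : ThreeCNF) :
    (φ.clauses.flatMap clauseCode).length ≤ 24 * (φ.n + 1) ^ 4 := by
  have h₁ : φ.clauses.length ≤ (2 * φ.n) ^ 3 := by
    have := φ.nodup.length_le_card
    simpa [Fintype.card_pi, mul_comm] using this
  have h₂ : ∀ l : List (Fin 3 → Fin φ.n × Bool),
      (l.flatMap clauseCode).length ≤ l.length * (3 * (φ.n + 1)) := by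
    intro l
    induction l with
    | nil => simp
    | cons cl l ih =>
      rw [List.flatMap_cons, List.length_append, List.length_cons, add_mul, one_mul]
      have := length_clauseCode_le cl
      omega
  calc _ ≤ φ.clauses.length * (3 * (φ.n + 1)) := h₂ _
    _ ≤ (2 * (φ.n + 1)) ^ 3 * (3 * (φ.n + 1)) := by
        refine Nat.mul_le_mul_right _ (h₁.trans ?_)
        gcongr
        omega
    _ = 24 * (φ.n + 1) ^ 4 := by ring

theorem length_flatMap_const {α β : Type*} (l : List α) (f : α → List β) (k : ℕ)
    (h : ∀ a, (f a).length = k) : (l.flatMap f).length = l.length * k := by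
  induction l with
  | nil => simp
  | cons a l ih =>
    rw [List.flatMap_cons, List.length_append, List.length_cons, ih, h]
    ring

theorem length_gridBits {g R c : ℕ} (act : Fin R → ZMod g → Bool) (lo : Fin R → Bool)
    (G : List (ZMod g)) {n : ℕ} (cls : List (Fin 3 → Fin n × Bool))
    (hc : ∀ i, G.countP (act i) = c) :
    (gridBits act lo G cls c).length =
      R + 2 * G.length + 2 * 2 ^ c + 4 + R * ((2 * G.length + 1) * (2 ^ c * 4)) := by
  have h₁ : ∀ i j, (columnCell act lo G i j).length = 2 ^ c * 4 := fun i j => by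
    rw [columnCell, length_flatMap_const _ _ 4 fun _ => rfl, List.length_range, hc]
  have h₂ : ∀ i, (checkCell act lo G cls i).length = 2 ^ c * 4 := fun i => by
    rw [checkCell, length_flatMap_const _ _ 4 fun _ => rfl, List.length_range, hc]
  have h₃ : ∀ i, (rowBits act lo G cls i).length = (2 * G.length + 1) * (2 ^ c * 4) := fun i => by
    rw [rowBits, List.length_append, List.length_append, h₂,
      length_flatMap_const _ _ _ (h₁ i), length_flatMap_const _ _ _ (h₁ i)]
    simp
    ring
  simp only [gridBits, List.length_append, List.length_replicate, List.length_singleton,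
    length_flatMap_const _ _ _ h₃, List.length_finRange]
  ring

/-- The time for writing and transferring the grid is `2 ^ c` times a polynomial in `n`. -/
theorem exists_time_bound (g R : ℕ) : ∃ K : ℕ, ∀ n c L m : ℕ, L ≤ 24 * (n + 1) ^ 4 → m ≤ n + g →
    writerTime g R c n L +
      (R + 2 * m + 2 * 2 ^ c + 4 + R * ((2 * m + 1) * (2 ^ c * 4)) + 1) ≤
      K * (2 ^ c * (n + 1) ^ 5) := by
  refine ⟨(R + 1) * (3 * (g + 1) * (84 + 4 * g) + 2) + 4 * (g + 1) + 34 + (R + 2 * (g + 1) + 7 +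
    12 * R * (g + 1)), fun n c L m hL hm => ?_⟩
  set X := n + 1 with hX
  have hX1 : 1 ≤ X := by omega
  have hP : 1 ≤ 2 ^ c := Nat.one_le_two_pow
  set P := 2 ^ c with hPdef
  have h5 : X ^ 4 ≤ X ^ 5 := Nat.pow_le_pow_right hX1 (by norm_num)
  have h1 : X ≤ X ^ 4 := by simpa using Nat.pow_le_pow_right hX1 (show 1 ≤ 4 by norm_num)
  have h0 : 1 ≤ X ^ 4 := Nat.one_le_pow _ _ hX1
  have hPX : X ^ 5 ≤ P * X ^ 5 := Nat.le_mul_of_pos_left _ hP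
  have hPX' : P ≤ P * X ^ 5 := Nat.le_mul_of_pos_right _ (by positivity)
  set Q := P * X ^ 5 with hQ
  have hQ1 : 1 ≤ Q := by omega
  have hng : n + g ≤ (g + 1) * X := by rw [hX]; nlinarith [Nat.zero_le (g * n)]
  have hmX : m ≤ (g + 1) * X := hm.trans hng
  have h2m : 2 * (n + g) + 1 ≤ 3 * (g + 1) * X := by rw [hX]; nlinarith [Nat.zero_le (g * n)]
  have h2m' : 2 * m + 1 ≤ 3 * (g + 1) * X := by omega
  have hXQ : (g + 1) * X ≤ (g + 1) * Q := Nat.mul_le_mul_left _ (by omega)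
  have hinner : P * (3 * L + 4 * (n + g) + 5) + 2 ≤ (84 + 4 * g) * (P * X ^ 4) := by
    have e : 3 * L + 4 * (n + g) + 5 + 2 ≤ (84 + 4 * g) * X ^ 4 := by
      have : 4 * g ≤ 4 * g * X ^ 4 := Nat.le_mul_of_pos_right _ (by omega)
      rw [add_mul]
      omega
    have e' := Nat.mul_le_mul_left P e
    calc _ ≤ P * (3 * L + 4 * (n + g) + 5 + 2) := by rw [mul_add P (3 * L + 4 * (n + g) + 5) 2]; omega
      _ ≤ P * ((84 + 4 * g) * X ^ 4) := e'
      _ = _ := by ring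
  have hrow : rowTime c (n + g) L ≤ (3 * (g + 1) * (84 + 4 * g) + 2) * Q := by
    rw [rowTime]
    calc _ ≤ 3 * (g + 1) * X * ((84 + 4 * g) * (P * X ^ 4)) + 2 * Q :=
          Nat.add_le_add (Nat.mul_le_mul h2m hinner) (by omega)
      _ = _ := by rw [hQ]; ring
  have hcell : (2 * m + 1) * (P * 4) ≤ 12 * (g + 1) * Q := by
    have hX5 : P * X ≤ Q := Nat.mul_le_mul_left P (h1.trans h5)
    calc _ ≤ 3 * (g + 1) * X * (P * 4) := Nat.mul_le_mul_right _ h2m'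
      _ = 12 * (g + 1) * (P * X) := by ring
      _ ≤ _ := Nat.mul_le_mul_left _ hX5
  have hR1 := Nat.mul_le_mul_left (R + 1) hrow
  have hR2 := Nat.mul_le_mul_left R hcell
  have hRQ : R ≤ R * Q := Nat.le_mul_of_pos_right _ hQ1
  have hL' : L ≤ 24 * Q := by omega
  rw [writerTime]
  calc _ ≤ (R + 1) * ((3 * (g + 1) * (84 + 4 * g) + 2) * Q) + 4 * ((g + 1) * Q) + 24 * Q + 10 * Q +
        (R * Q + 2 * ((g + 1) * Q) + 7 * Q + R * (12 * (g + 1) * Q)) := by omega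
    _ = _ := by ring

/-! ### The reduction -/

/-- The machine for 3-SAT that writes down the grid and runs `M` on it. -/
noncomputable def satMachine {g R : ℕ} [NeZero g] [NeZero R] (act : Fin R → ZMod g → Bool)
    (lo : Fin R → Bool) (M : TM2ComputableAux Bool Bool) : TM2ComputableAux Bool Bool where
  tm := FinTM2.compRev (machine act lo) M.tm id M.inputAlphabet.symm
  inputAlphabet := Equiv.refl Bool
  outputAlphabet := M.outputAlphabet

theorem decidesInTime_satMachine {g R : ℕ} [NeZero g] [NeZero R] {act : Fin R → ZMod g → Bool}
    {lo : Fin R → Bool} (hact : ∀ i h, (residues g (g * h)).countP (act i) = 3 * h)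
    (hcover : ∀ f : Fin 3 → ZMod g, ∃ i i', act i' = act i ∧ lo i = false ∧ lo i' = true ∧
      ∀ k, act i (f k) = true)
    {M : TM2ComputableAux Bool Bool} {T : GridTilingInstance → ℝ} {T' : ThreeCNF → ℝ}
    (hM : DecidesInTime GridTilingInstance.encode GridTilingInstance.MonotoneSolvable T M)
    (hT : ∀ φ : ThreeCNF,
      ((writerTime g R (3 * ((φ.n + g - 1) / g)) φ.n (φ.clauses.flatMap clauseCode).length +
        ((gridBits act lo (residues g (width g φ.n)) φ.clauses
          (3 * ((φ.n + g - 1) / g))).length + 1) : ℕ) : ℝ) +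
        T (grid act lo φ (3 * ((φ.n + g - 1) / g))) ≤ T' φ) :
    DecidesInTime ThreeCNF.encode ThreeCNF.Satisfiable T' (satMachine act lo M) := by
  intro φ
  have hc : ∀ i, (residues g (width g φ.n)).countP (act i) = 3 * ((φ.n + g - 1) / g) :=
    fun i => hact i _
  obtain ⟨answer, m, hans, hm, ⟨hrun⟩⟩ := hM (grid act lo φ (3 * ((φ.n + g - 1) / g)))
  have hA := runsIn_machine (lo := lo) φ hc
  rw [← encode_grid act lo φ _ hc] at hA
  -- The output stack holds the encoding with its end on top; the reversal during the transfer
  -- restores the order.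
  have hB : RunsIn M.tm.step (initList M.tm ((List.map M.inputAlphabet.symm
      (grid act lo φ (3 * ((φ.n + g - 1) / g))).encode.reverse).reverse))
      (haltList M.tm ([answer].map M.outputAlphabet.symm)) m := by
    rw [← List.map_reverse, List.reverse_reverse]
    exact ⟨hrun⟩
  have h := FinTM2.runsIn_compRev (A := machine act lo) (B := M.tm) id M.inputAlphabet.symm hA hB
  refine ⟨answer, writerTime g R (3 * ((φ.n + g - 1) / g)) φ.n
      (φ.clauses.flatMap clauseCode).length + ((gridBits act lo (residues g (width g φ.n)) φ.clauses
        (3 * ((φ.n + g - 1) / g))).length + 1) + m, ?_, ?_, ?_⟩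
  · exact hans.trans ⟨satisfiable_of_monotoneSolvable_grid hc hcover, monotoneSolvable_grid hc⟩
  · refine le_trans ?_ (hT φ)
    rw [Nat.cast_add]
    gcongr
  · have e : φ.encode.map (satMachine act lo M).inputAlphabet.symm = φ.encode := List.map_id _
    rw [e]
    have hl : (grid act lo φ (3 * ((φ.n + g - 1) / g))).encode.reverse.length =
        (gridBits act lo (residues g (width g φ.n)) φ.clauses (3 * ((φ.n + g - 1) / g))).length := by
      rw [List.length_reverse, encode_grid act lo φ _ hc]
    rw [← hl]
    exact h

end GridWriter

/-! ### Choice of parameters and the final estimate -/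

theorem exists_pow_le_const_mul_two_rpow (k : ℕ) {η : ℝ} (hη : 0 < η) :
    ∃ K : ℝ, 0 < K ∧ ∀ n : ℕ, ((n : ℝ) + 1) ^ k ≤ K * (2 : ℝ) ^ (η * n) := by
  have hr : 1 < (2 : ℝ) ^ η := Real.one_lt_rpow (by norm_num) hη
  obtain ⟨B, hB⟩ := (tendsto_pow_const_div_const_pow_of_one_lt k hr).bddAbove_range
  have hB' : ∀ n : ℕ, (n : ℝ) ^ k ≤ B * ((2 : ℝ) ^ η) ^ n := fun n => by
    have h := hB ⟨n, rfl⟩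
    rwa [div_le_iff₀ (by positivity)] at h
  -- The bound is applied at `n + 1`, which costs the factor `2 ^ η`; `|B| + 1` makes the constant
  -- positive.
  refine ⟨(|B| + 1) * (2 : ℝ) ^ η, by positivity, fun n => ?_⟩
  have h := hB' (n + 1)
  push_cast at h
  refine h.trans ?_
  rw [Real.rpow_mul (by norm_num), Real.rpow_natCast, pow_succ, mul_assoc (|B| + 1),
    mul_comm ((2 : ℝ) ^ η) (((2 : ℝ) ^ η) ^ n)]
  gcongr
  linarith [le_abs_self B]

theorem mainTheorem11 (hETH : ExponentialTimeHypothesis) (b : ℝ) (hb : 0 < b) :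
    ∃ ε : ℝ, 0 < ε ∧ ∀ C : ℝ, 0 < C →
      ¬ ∃ M : Turing.TM2ComputableAux Bool Bool,
        DecidesInTime GridTilingInstance.encode GridTilingInstance.MonotoneSolvable
          (fun I => C * (2 : ℝ) ^ (ε * ((I.x : ℝ) * (I.y : ℝ))) * (I.N : ℝ) ^ b) M := by
  obtain ⟨δ, hδ, hno⟩ := hETH
  -- These bounds make both `3 n / g` and `3 b n / g` at most `δ n / 4`, so that `2 ^ c` and `N ^ b`
  -- are each `O(2 ^ (δ n / 4))`.
  obtain ⟨g, hg3, hg1, hgb⟩ : ∃ g : ℕ, 3 ≤ g ∧ 12 / δ ≤ g ∧ 12 * b / δ ≤ g := by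
    refine ⟨max 3 (max ⌈12 / δ⌉₊ ⌈12 * b / δ⌉₊), le_max_left _ _, ?_, ?_⟩
    · exact (Nat.le_ceil _).trans (by exact_mod_cast (le_max_left _ _).trans (le_max_right _ _))
    · exact (Nat.le_ceil _).trans (by exact_mod_cast (le_max_right _ _).trans (le_max_right _ _))
  have : NeZero g := ⟨by omega⟩
  have hg0 : (0 : ℝ) < g := by exact_mod_cast NeZero.pos g
  obtain ⟨R, hR, act, lo, hact, hcover⟩ := GridWriter.exists_rows g hg3
  have hR0 : (0 : ℝ) < R := by exact_mod_cast NeZero.pos R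
  -- Since `x y = R (2 m + 1)` with `m < n + g`, this makes `ε x y` at most `δ n / 2` plus a
  -- constant; together with `N ^ b` the exponent is `3 δ n / 4`.
  refine ⟨δ / (4 * R), by positivity, fun C hC => ?_⟩
  rintro ⟨M, hM⟩
  obtain ⟨K, hK⟩ := GridWriter.exists_time_bound g R
  obtain ⟨K₂, hK₂0, hK₂⟩ := exists_pow_le_const_mul_two_rpow 5 (show 0 < δ / 4 by positivity)
  -- The first summand pays for writing and transferring the grid, the second for running `M`. The
  -- factors `8` and `16` come from `c ≤ 3 n / g + 3` and `N = 2 * 2 ^ c`.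
  refine hno ⟨K * (8 * K₂) + C * (2 : ℝ) ^ (δ / 4 * (2 * g + 1)) * 16 ^ b,
    GridWriter.satMachine act lo M,
    GridWriter.decidesInTime_satMachine hact hcover hM fun φ => ?_⟩
  set c := 3 * ((φ.n + g - 1) / g) with hc
  have hcount : ∀ i, (residues g (GridWriter.width g φ.n)).countP (act i) = c := fun i => hact i _
  obtain ⟨-, hw⟩ := GridWriter.le_width (g := g) φ.n
  have hn0 : (0 : ℝ) ≤ φ.n := Nat.cast_nonneg _
  have hcR : (c : ℝ) ≤ 3 * φ.n / g + 3 := by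
    have h : (((φ.n + g - 1) / g : ℕ) : ℝ) ≤ ((φ.n + g : ℕ) : ℝ) / g :=
      Nat.cast_div_le.trans (by gcongr; omega)
    rw [hc, Nat.cast_mul]
    push_cast at h ⊢
    calc (3 : ℝ) * (((φ.n + g - 1) / g : ℕ) : ℝ) ≤ 3 * ((φ.n + g) / g) := by gcongr
      _ = _ := by field_simp
  have hgδ : 3 * φ.n / g ≤ δ / 4 * φ.n := by
    rw [div_le_iff₀ hδ] at hg1
    rw [div_le_iff₀ hg0]
    nlinarith
  have hgbδ : 3 * φ.n / g * b ≤ δ / 4 * φ.n := by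
    rw [div_le_iff₀ hδ] at hgb
    rw [div_mul_eq_mul_div, div_le_iff₀ hg0]
    nlinarith
  have h2c : (2 : ℝ) ^ c ≤ 8 * (2 : ℝ) ^ (3 * φ.n / g : ℝ) := by
    rw [← Real.rpow_natCast 2 c]
    calc (2 : ℝ) ^ (c : ℝ) ≤ (2 : ℝ) ^ (3 * φ.n / g + 3 : ℝ) :=
          Real.rpow_le_rpow_of_exponent_le (by norm_num) hcR
      _ = _ := by rw [Real.rpow_add (by norm_num), mul_comm]; norm_num
  have hδn : ∀ s : ℝ, s ≤ δ * φ.n → (2 : ℝ) ^ s ≤ (2 : ℝ) ^ (δ * (φ.n : ℝ)) := fun s hs =>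
    Real.rpow_le_rpow_of_exponent_le (by norm_num) hs
  have hδn0 : 0 ≤ δ * φ.n := by positivity
  rw [add_mul]
  refine add_le_add ?_ ?_
  · have h := hK φ.n c _ _ (GridWriter.length_clauses_le φ) hw.le
    rw [← residues_length g (GridWriter.width g φ.n),
      ← GridWriter.length_gridBits act lo _ φ.clauses hcount] at h
    calc _ ≤ ((K * (2 ^ c * (φ.n + 1) ^ 5) : ℕ) : ℝ) := by exact_mod_cast h
      _ = K * ((2 : ℝ) ^ c * ((φ.n : ℝ) + 1) ^ 5) := by push_cast; ring
      _ ≤ K * ((8 * (2 : ℝ) ^ (3 * φ.n / g : ℝ)) * (K₂ * (2 : ℝ) ^ (δ / 4 * φ.n))) := by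
          gcongr
          exact hK₂ _
      _ = K * (8 * K₂) * (2 : ℝ) ^ (3 * φ.n / g + δ / 4 * φ.n : ℝ) := by
          rw [Real.rpow_add (by norm_num)]; ring
      _ ≤ _ := mul_le_mul_of_nonneg_left (hδn _ (by linarith)) (by positivity)
  · have hx : ((GridWriter.grid act lo φ c).x : ℝ) = R := rfl
    have hy : ((GridWriter.grid act lo φ c).y : ℝ) ≤ 2 * φ.n + 2 * g + 1 := by
      change ((2 * GridWriter.width g φ.n + 1 : ℕ) : ℝ) ≤ _
      have : (GridWriter.width g φ.n : ℝ) ≤ φ.n + g := by exact_mod_cast hw.le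
      push_cast
      linarith
    have hN : ((GridWriter.grid act lo φ c).N : ℝ) = 2 * 2 ^ c := by
      change ((2 * 2 ^ c : ℕ) : ℝ) = _
      push_cast; ring
    rw [hx, hN]
    have h₁ : δ / (4 * R) * (R * ((GridWriter.grid act lo φ c).y : ℝ)) ≤
        δ / 4 * (2 * g + 1) + δ / 2 * φ.n := by
      calc _ = δ / 4 * ((GridWriter.grid act lo φ c).y : ℝ) := by field_simp
        _ ≤ δ / 4 * (2 * φ.n + 2 * g + 1) := by gcongr
        _ = _ := by ring
    have h₂ : ((2 : ℝ) * 2 ^ c) ^ b ≤ 16 ^ b * (2 : ℝ) ^ (δ / 4 * φ.n) := by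
      calc ((2 : ℝ) * 2 ^ c) ^ b ≤ (16 * (2 : ℝ) ^ (3 * φ.n / g : ℝ)) ^ b := by
            refine Real.rpow_le_rpow (by positivity) (by linarith) hb.le
        _ = 16 ^ b * (2 : ℝ) ^ (3 * φ.n / g * b : ℝ) := by
            rw [Real.mul_rpow (by norm_num) (by positivity), ← Real.rpow_mul (by norm_num)]
        _ ≤ _ := by
            gcongr
            norm_num
    calc _ ≤ C * (2 : ℝ) ^ (δ / 4 * (2 * g + 1) + δ / 2 * φ.n) *
          (16 ^ b * (2 : ℝ) ^ (δ / 4 * φ.n)) := by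
          gcongr
          norm_num
      _ = C * (2 : ℝ) ^ (δ / 4 * (2 * g + 1)) * 16 ^ b *
          (2 : ℝ) ^ (δ / 2 * φ.n + δ / 4 * φ.n) := by
          rw [Real.rpow_add (by norm_num), Real.rpow_add (by norm_num)]; ring
      _ ≤ _ := mul_le_mul_of_nonneg_left (hδn _ (by linarith)) (by positivity)
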